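/- Theorem 2. For $1\le s<\infty$ and a $2\pi$-periodic real function $f$ put $\|f\|_s=\big(\int_0^{2\pi}|f(t)|^s\,dt\big)^{1/s}$. Let $\alpha>0$, $0<r<1$, $\beta\in\mathbb R$, $1\le p<\infty$, and let $$P_{\alpha,r,\beta}(t)=\sum_{k=1}^{\infty}e^{-\alpha k^r}\cos\Big(kt-\frac{\beta\pi}{2}\Big).$$ Let $C^{\alpha,r}_{\beta,p}$ be the set of all $2\pi$-periodic functions $f$ such that, for some $a_0\in\mathbb R$ and some $2\pi$-periodic measurable $\varphi$ with $\|\varphi\|_p\le 1$ and $\int_0^{2\pi}\varphi(t)\,dt=0$, $$f(x)=\frac{a_0}{2}+\frac1\pi\int_{-\pi}^{\pi}P_{\alpha,r,\beta}(x-t)\varphi(t)\,dt\qquad\text{for all }x\in\mathbb R.$$ Let $$\mathcal E_n(C^{\alpha,r}_{\beta,p})_C=\sup_{f\in C^{\alpha,r}_{\beta,p}}\ \max_{x\in\mathbb R}|f(x)-S_{n-1}(f;x)|,$$ where $S_{n-1}(f;\cdot)$ is the partial Fourier sum of $f$ of order $n-1$. Let $n_0(\alpha,r,p)$ be the smallest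 positive integer $n$ such that $$\frac{1}{\alpha r}\frac1{n^r}+\frac{\alpha r\,p}{n^{1-r}}\le\begin{cases}\frac1{14},&p=1,\\[2pt] \frac{1}{(3\pi)^3}\cdot\frac{p-1}{p},&1<p<\infty.\end{cases}$$ If $1<p<\infty$ and $\frac1p+\frac1{p'}=1$, then for every $n\ge n_0(\alpha,r,p)$ $$\mathcal E_n(C^{\alpha,r}_{\beta,p})_C=e^{-\alpha n^r}n^{\frac{1-r}{p}}\Bigg(\frac{\|\cos\|_{p'}}{\pi^{1+\frac1{p'}}(\alpha r)^{\frac1p}}\bigg(\int_0^\infty\frac{dt}{(t^2+1)^{\frac{p'}2}}\bigg)^{\frac1{p'}}+\gamma_{n,p}\bigg(\frac{1}{p'-1}\frac{(\alpha r)^{\frac{p'-1}{p}}}{n^{(1-r)(p'-1)}}+\frac{p^{\frac1{p'}}}{(\alpha r)^{1+\frac1p}}\frac1{n^r}+\frac1{n^{\frac{1-r}{p}}}\bigg)\Bigg),$$ and for $p=1$ and every $n\ge n_0(\alpha,r,1)$ $$\mathcal E_n(C^{\alpha,r}_{\beta,1})_C=e^{-\alpha n^r}n^{1-r}\Bigg(\frac1{\pi\alpha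 r}+\gamma_{n,1}\bigg(\frac{1}{(\alpha r)^2}\frac1{n^r}+\frac1{n^{1-r}}\bigg)\Bigg),$$ where the quantities $\gamma_{n,p}=\gamma_{n,p}(\alpha,r,\beta)$ satisfy $|\gamma_{n,p}|\le(14\pi)^2$. -/

import Mathlib

open MeasureTheory Set
open scoped ENNReal Real

noncomputable section

namespace PoissonFourier

/-- The norm of `L_p`, `1 ≤ p ≤ ∞`, for `2π`-periodic functions: the `L_p` norm over `[0, 2π)`. -/
def periodNorm (p : ℝ≥0∞) (φ : ℝ → ℝ) : ℝ≥0∞ :=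
  eLpNorm φ p (volume.restrict (Ico 0 (2 * π)))

/-- The generalized Poisson kernel
`P_{α,r,β}(t) = ∑_{k ≥ 1} exp (-α k ^ r) cos (k t - β π / 2)`. -/
def poissonKernel (α r β t : ℝ) : ℝ :=
  ∑' k : ℕ, Real.exp (-α * ((k + 1 : ℕ) : ℝ) ^ r) *
    Real.cos (((k + 1 : ℕ) : ℝ) * t - β * π / 2)

/-- `B_p^0`: the `2π`-periodic functions of `L_p` with norm at most `1` that are
orthogonal to the constants. -/
def zeroMeanBall (p : ℝ≥0∞) : Set (ℝ → ℝ) :=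
  {φ | Function.Periodic φ (2 * π) ∧
    AEStronglyMeasurable φ (volume.restrict (Ico 0 (2 * π))) ∧
    periodNorm p φ ≤ 1 ∧
    ∫ t in Ico 0 (2 * π), φ t = 0}

/-- The class `C^{α,r}_{β,p}` of generalized Poisson integrals. -/
def poissonClass (α r β : ℝ) (p : ℝ≥0∞) : Set (ℝ → ℝ) :=
  {f | Function.Periodic f (2 * π) ∧
    ∃ a₀ : ℝ, ∃ φ ∈ zeroMeanBall p, ∀ x : ℝ,
      f x = a₀ / 2 + 1 / π * ∫ t in (-π)..π, poissonKernel α r β (x - t) * φ t}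

/-- The Fourier cosine coefficient `a_k(f)`. -/
def cosCoeff (f : ℝ → ℝ) (k : ℕ) : ℝ :=
  1 / π * ∫ t in (-π)..π, f t * Real.cos (k * t)

/-- The Fourier sine coefficient `b_k(f)`. -/
def sinCoeff (f : ℝ → ℝ) (k : ℕ) : ℝ :=
  1 / π * ∫ t in (-π)..π, f t * Real.sin (k * t)

/-- The partial Fourier sum `S_m(f; x)` of order `m`. -/
def fourierSum (f : ℝ → ℝ) (m : ℕ) (x : ℝ) : ℝ :=
  cosCoeff f 0 / 2 +
    ∑ k ∈ Finset.Icc 1 m, (cosCoeff f k * Real.cos (k * x) + sinCoeff f k * Real.sin (k * x))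

/-- The uniform norm, as an extended real (it is finite exactly for bounded functions). -/
def uniformNorm (g : ℝ → ℝ) : EReal :=
  ⨆ x : ℝ, ((|g x| : ℝ) : EReal)

/-- `𝓔_n(C^{α,r}_{β,p})_C`, for `n ≥ 1`: the supremum over the class of the uniform deviation
of a function from its partial Fourier sum of order `n - 1`. -/
def fourierDeviation (α r β : ℝ) (p : ℝ≥0∞) (n : ℕ) : EReal :=
  ⨆ f ∈ poissonClass α r β p, uniformNorm (fun x => f x - fourierSum f (n - 1) x)

/-- The threshold `n₀(α,r,p)` for `1 ≤ p < ∞`: the least positive integer `n` satisfying the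
inequality below. For `α > 0` and `0 < r < 1` the set is nonempty, since the left side tends to
`0`, and it contains every larger integer, since the left side decreases in `n`. -/
def threshold (α r p : ℝ) : ℕ :=
  sInf {n : ℕ | 1 ≤ n ∧
    1 / (α * r) * (1 / (n : ℝ) ^ r) + α * r * p / (n : ℝ) ^ (1 - r) ≤
      if p = 1 then 1 / 14 else 1 / (3 * π) ^ 3 * ((p - 1) / p)}

end PoissonFourier

end

/-! Write `q` for the conjugate exponent, `δ = α r n ^ (r - 1)`, `ν = n δ = α r n ^ r`, `b = β π /
2` and `E = exp (-α n ^ r)`. The difference between `f` and its partial sum is `1 / π` times the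
convolution of `φ` with the tail `Q` of the kernel (`sub_fourierSum_eq`), and `Q t = E Re (exp (i (n
t - b)) G t)`, where `G` (`tailSeries`) varies slowly on the scale `1 / n`.

Duality. Hölder bounds the deviation by `‖Q‖_q / π`. For the lower bound the zero mean of `φ` has to
be respected: a norming function `ψ` is replaced by `(ψ - ψ (· + π / n)) / 2`. Since a shift by `π /
n` reverses the sign of the carrier, `Q + Q (· + π / n)` is small, and half its norm is all that is
lost (`circleNorm_le_fourierDeviation`). For `p = 1` the norming function is replaced by an
approximate identity (`half_difference_le_fourierDeviation_one`).

Amplitude. The coefficients of `G` dominate `exp (-δ k)`. The difference of the two sequences has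
sum at most `η / δ` and total variation at most `2 η`, with `η = δ + 1 / (ν - 1)`. Hence `G` differs
from the geometric sum `1 / (1 - exp (-δ + i t))` by at most `4 η / √(δ² + t²)`
(`norm_tailSeries_sub_mul_sqrt_le`), and the modulus of that sum is `1 / √(δ² + t²)` up to a bounded
error.

Norm. Averaging over the phase `b` turns the norm of the modulated amplitude into `‖cos‖_q (2 π) ^
(-1 / q)` times the norm of the amplitude, exactly. A change of phase is a translation by a fraction
of `1 / n`, so a single phase differs from the average only by the oscillation of the amplitude
(`abs_circleNorm_modulate_sub_le`). Extending the integral of `(δ² + t²) ^ (-q / 2)` from the period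
to the line produces the main term, with error controlled by `lineNorm_sub_le`. -/

noncomputable section

namespace PoissonFourier

open Filter Topology
open Complex (I)

/-! ### Coefficients of the tail compared with a geometric progression -/

/-- The exponent `δ = α r n ^ (r - 1)` of the geometric series that models the tail of the
kernel. -/
def decayRate (α r : ℝ) (n : ℕ) : ℝ := α * r * (n : ℝ) ^ (r - 1)

/-- The coefficients `exp (-α ((n + k) ^ r - n ^ r))` of the normalized tail of the kernel. -/
def decayCoeff (α r : ℝ) (n k : ℕ) : ℝ :=
  Real.exp (-α * (((n + k : ℕ) : ℝ) ^ r - (n : ℝ) ^ r))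

lemma decayCoeff_zero (α r : ℝ) (n : ℕ) : decayCoeff α r n 0 = 1 := by simp [decayCoeff]

lemma decayCoeff_pos (α r : ℝ) (n k : ℕ) : 0 < decayCoeff α r n k := Real.exp_pos _

lemma decayRate_pos {α r : ℝ} (hα : 0 < α) (hr0 : 0 < r) {n : ℕ} (hn : 1 ≤ n) :
    0 < decayRate α r n := by
  have : (0 : ℝ) < n := by exact_mod_cast hn
  unfold decayRate; positivity

lemma nat_mul_decayRate (α r : ℝ) {n : ℕ} (hn : 1 ≤ n) :
    n * decayRate α r n = α * r * (n : ℝ) ^ r := by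
  have h : (0 : ℝ) < n := by exact_mod_cast hn
  rw [decayRate, Real.rpow_sub_one h.ne']
  field_simp

/-- Concavity of `y ^ r`, through Bernoulli's inequality: unit increments beyond `x` do not exceed
the derivative at `x`. With `x = n` this bounds the ratio of consecutive coefficients below by `exp
(-δ)`. -/
lemma rpow_add_one_sub_le {r x y : ℝ} (hr0 : 0 < r) (hr1 : r < 1) (hx : 0 < x) (hxy : x ≤ y) :
    (y + 1) ^ r - y ^ r ≤ r * x ^ (r - 1) := by
  have hy : 0 < y := hx.trans_le hxy
  have h1 : (1 + 1 / y) ^ r ≤ 1 + r * (1 / y) :=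
    rpow_one_add_le_one_add_mul_self (by have := one_div_pos.2 hy; linarith) hr0.le hr1.le
  have h2 : (y + 1) ^ r = y ^ r * (1 + 1 / y) ^ r := by
    rw [← Real.mul_rpow hy.le (by positivity)]
    congr 1; field_simp
  have h3 : y ^ (r - 1) ≤ x ^ (r - 1) := Real.rpow_le_rpow_of_nonpos hx hxy (by linarith)
  have h4 : y ^ (r - 1) = y ^ r / y := Real.rpow_sub_one hy.ne' r
  calc (y + 1) ^ r - y ^ r ≤ y ^ r * (1 + r * (1 / y)) - y ^ r := by rw [h2]; gcongr
    _ = r * y ^ (r - 1) := by rw [h4]; ring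
    _ ≤ r * x ^ (r - 1) := by gcongr

lemma exp_neg_decayRate_mul_le {α r : ℝ} (hα : 0 < α) (hr0 : 0 < r) (hr1 : r < 1) {n : ℕ}
    (hn : 1 ≤ n) (k : ℕ) :
    Real.exp (-decayRate α r n) * decayCoeff α r n k ≤ decayCoeff α r n (k + 1) := by
  have h : (0 : ℝ) < n := by exact_mod_cast hn
  rw [decayCoeff, decayCoeff, ← Real.exp_add]
  apply Real.exp_le_exp.2
  have h1 := rpow_add_one_sub_le (y := ((n + k : ℕ) : ℝ)) hr0 hr1 h (by push_cast; simp)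
  have h2 : ((n + (k + 1) : ℕ) : ℝ) = ((n + k : ℕ) : ℝ) + 1 := by push_cast; ring
  rw [h2, decayRate]
  nlinarith

lemma exp_pow_le_decayCoeff {α r : ℝ} (hα : 0 < α) (hr0 : 0 < r) (hr1 : r < 1) {n : ℕ}
    (hn : 1 ≤ n) (k : ℕ) :
    Real.exp (-decayRate α r n) ^ k ≤ decayCoeff α r n k := by
  induction k with
  | zero => simp [decayCoeff_zero]
  | succ k ih =>
    rw [pow_succ']
    exact (mul_le_mul_of_nonneg_left ih (Real.exp_pos _).le).trans
      (exp_neg_decayRate_mul_le hα hr0 hr1 hn k)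

/-- From `y ^ r ≥ 1 + r log y` at `y = 1 + k / n`. The power `-ν` decays fast enough to be summed
explicitly once `ν > 1`. -/
lemma decayCoeff_le_rpow {α r : ℝ} (hα : 0 < α) {n : ℕ}
    (hn : 1 ≤ n) (k : ℕ) :
    decayCoeff α r n k ≤ (1 + k / n : ℝ) ^ (-(n * decayRate α r n)) := by
  have h : (0 : ℝ) < n := by exact_mod_cast hn
  have hy : (0 : ℝ) < 1 + k / n := by positivity
  rw [Real.rpow_def_of_pos hy, decayCoeff]
  apply Real.exp_le_exp.2
  have h2 : ((n + k : ℕ) : ℝ) ^ r = (n : ℝ) ^ r * (1 + k / n : ℝ) ^ r := by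
    rw [← Real.mul_rpow h.le hy.le]
    congr 1; push_cast; field_simp
  have h3 : Real.log (1 + k / n : ℝ) * r + 1 ≤ (1 + k / n : ℝ) ^ r := by
    rw [Real.rpow_def_of_pos hy]; exact Real.add_one_le_exp _
  rw [h2, nat_mul_decayRate α r hn]
  have h4 : 0 < α * (n : ℝ) ^ r := by positivity
  nlinarith

/-- Integral comparison: the right side is the integral of the decreasing function `(1 + s / n) ^
(-ν)` over `[x, x + 1]`, in a form that telescopes. -/
lemma rpow_neg_le_sub {ν x n : ℝ} (hν : 1 < ν) (hn : 0 < n) (hx : 0 ≤ x) :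
    (1 + (x + 1) / n) ^ (-ν) ≤
      n / (ν - 1) * ((1 + x / n) ^ (1 - ν) - (1 + (x + 1) / n) ^ (1 - ν)) := by
  set y := 1 + (x + 1) / n with hy
  have hy0 : 0 < y := by positivity
  have hny : n * y = n + x + 1 := by rw [hy]; field_simp; ring
  have hny1 : 1 < n * y := by rw [hny]; linarith
  set u := 1 / (n * y) with hu
  have hu1 : u < 1 := by rw [hu, div_lt_one (by linarith)]; exact hny1
  have hu0 : 0 < 1 - u := by linarith
  have e1 : 1 + x / n = y * (1 - u) := by rw [hu, hy]; field_simp; ring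
  -- Both `exp y ≥ 1 + y` and `log (1 - u) ≤ -u` enter, the latter multiplied by `1 - ν < 0`.
  have e2 : 1 + (ν - 1) * u ≤ (1 - u) ^ (1 - ν) := by
    rw [Real.rpow_def_of_pos hu0]
    have := Real.add_one_le_exp (Real.log (1 - u) * (1 - ν))
    have := Real.log_le_sub_one_of_pos hu0
    nlinarith
  have e3 : y ^ (-ν) = y ^ (1 - ν) / y := by
    rw [← Real.rpow_sub_one hy0.ne']; congr 1; ring
  rw [e1, Real.mul_rpow hy0.le hu0.le, e3]
  have hp : 0 < y ^ (1 - ν) := by positivity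
  have hv : 0 < ν - 1 := by linarith
  calc y ^ (1 - ν) / y = n / (ν - 1) * (y ^ (1 - ν) * (1 + (ν - 1) * u) - y ^ (1 - ν)) := by
        rw [hu]; field_simp; ring
    _ ≤ _ := by gcongr

lemma sum_decayCoeff_le {α r : ℝ} (hα : 0 < α) {n : ℕ}
    (hn : 1 ≤ n) (hν : 1 < n * decayRate α r n) (N : ℕ) :
    ∑ k ∈ Finset.range N, decayCoeff α r n k ≤ 1 + n / (n * decayRate α r n - 1) := by
  have h : (0 : ℝ) < n := by exact_mod_cast hn
  set ν := n * decayRate α r n with hνd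
  have hv : 0 < ν - 1 := by linarith
  set T : ℕ → ℝ := fun k => n / (ν - 1) * (1 + k / n : ℝ) ^ (1 - ν) with hT
  have hstep : ∀ k, decayCoeff α r n (k + 1) ≤ T k - T (k + 1) := fun k => by
    refine (decayCoeff_le_rpow hα hn (k + 1)).trans ?_
    have := rpow_neg_le_sub (x := k) hν h (by positivity)
    simp only [hT]
    push_cast
    rw [← mul_sub]
    exact this
  have hsum : ∀ N, ∑ k ∈ Finset.range N, decayCoeff α r n (k + 1) ≤ T 0 - T N := fun N => by
    rw [← Finset.sum_range_sub']
    exact Finset.sum_le_sum fun k _ => hstep k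
  have hT0 : T 0 = n / (ν - 1) := by simp [hT]
  have hTN : ∀ N, 0 ≤ T N := fun N => by simp only [hT]; positivity
  calc ∑ k ∈ Finset.range N, decayCoeff α r n k
      ≤ ∑ k ∈ Finset.range (N + 1), decayCoeff α r n k :=
        Finset.sum_le_sum_of_subset_of_nonneg (by simp)
          fun k _ _ => (decayCoeff_pos α r n k).le
    _ = ∑ k ∈ Finset.range N, decayCoeff α r n (k + 1) + 1 := by
        rw [Finset.sum_range_succ', decayCoeff_zero]
    _ ≤ _ := by linarith [hsum N, hTN N]

lemma summable_decayCoeff {α r : ℝ} (hα : 0 < α) {n : ℕ}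
    (hn : 1 ≤ n) (hν : 1 < n * decayRate α r n) : Summable (decayCoeff α r n) :=
  summable_of_sum_range_le (fun k => (decayCoeff_pos α r n k).le) (sum_decayCoeff_le hα hn hν)

/-- The size of the perturbation that replaces the coefficients by a geometric progression. -/
def modelError (α r : ℝ) (n : ℕ) : ℝ :=
  decayRate α r n + 1 / (n * decayRate α r n - 1)

lemma decayRate_mul_tsum_le {α r : ℝ} (hα : 0 < α) (hr0 : 0 < r) {n : ℕ}
    (hn : 1 ≤ n) (hν : 1 < n * decayRate α r n) :
    decayRate α r n * ∑' k, decayCoeff α r n k ≤ 1 + modelError α r n := by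
  have hδ := decayRate_pos hα hr0 hn
  have h1 : ∑' k, decayCoeff α r n k ≤ 1 + n / (n * decayRate α r n - 1) :=
    Real.tsum_le_of_sum_range_le (fun k => (decayCoeff_pos α r n k).le) (sum_decayCoeff_le hα hn hν)
  have hv : 0 < n * decayRate α r n - 1 := by linarith
  calc _ ≤ decayRate α r n * (1 + n / (n * decayRate α r n - 1)) := by gcongr
    _ = decayRate α r n + n * decayRate α r n / (n * decayRate α r n - 1) := by ring
    _ = 1 + modelError α r n := by
      rw [modelError]
      generalize (n : ℝ) * decayRate α r n = v at hv
      field_simp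
      ring

lemma exp_neg_decayRate_lt_one {α r : ℝ} (hα : 0 < α) (hr0 : 0 < r) {n : ℕ} (hn : 1 ≤ n) :
    Real.exp (-decayRate α r n) < 1 := by
  rw [Real.exp_lt_one_iff]; linarith [decayRate_pos hα hr0 hn]

/-- The difference between the coefficients and the geometric progression. -/
def coeffDiff (α r : ℝ) (n k : ℕ) : ℝ := decayCoeff α r n k - Real.exp (-decayRate α r n) ^ k

lemma coeffDiff_nonneg {α r : ℝ} (hα : 0 < α) (hr0 : 0 < r) (hr1 : r < 1) {n : ℕ}
    (hn : 1 ≤ n) (k : ℕ) : 0 ≤ coeffDiff α r n k :=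
  sub_nonneg.2 (exp_pow_le_decayCoeff hα hr0 hr1 hn k)

lemma summable_coeffDiff {α r : ℝ} (hα : 0 < α) (hr0 : 0 < r) {n : ℕ}
    (hn : 1 ≤ n) (hν : 1 < n * decayRate α r n) : Summable (coeffDiff α r n) :=
  (summable_decayCoeff hα hn hν).sub
    (summable_geometric_of_lt_one (Real.exp_pos _).le (exp_neg_decayRate_lt_one hα hr0 hn))

/-- The geometric part has sum `1 / (1 - exp (-δ)) ≥ 1 / δ`, which cancels the leading `1` in
`decayRate_mul_tsum_le`. -/
lemma decayRate_mul_tsum_coeffDiff_le {α r : ℝ} (hα : 0 < α) (hr0 : 0 < r) {n : ℕ}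
    (hn : 1 ≤ n) (hν : 1 < n * decayRate α r n) :
    decayRate α r n * ∑' k, coeffDiff α r n k ≤ modelError α r n := by
  have hδ := decayRate_pos hα hr0 hn
  have hlt := exp_neg_decayRate_lt_one hα hr0 hn
  have h1 : ∑' k, coeffDiff α r n k =
      ∑' k, decayCoeff α r n k - (1 - Real.exp (-decayRate α r n))⁻¹ := by
    rw [← tsum_geometric_of_lt_one (Real.exp_pos _).le hlt]
    exact (summable_decayCoeff hα hn hν).tsum_sub
      (summable_geometric_of_lt_one (Real.exp_pos _).le hlt)
  have h2 : 1 ≤ decayRate α r n * (1 - Real.exp (-decayRate α r n))⁻¹ := by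
    rw [← div_eq_mul_inv, one_le_div (by linarith)]
    linarith [Real.add_one_le_exp (-decayRate α r n)]
  rw [h1, mul_sub]
  linarith [decayRate_mul_tsum_le hα hr0 hn hν]

/-- The increment is the difference of two nonnegative quantities, `c (k + 1) - exp (-δ) c k` and
`(1 - exp (-δ)) d k`, for the coefficients `c` and their differences `d`. -/
lemma abs_coeffDiff_sub_le {α r : ℝ} (hα : 0 < α) (hr0 : 0 < r) (hr1 : r < 1) {n : ℕ}
    (hn : 1 ≤ n) (k : ℕ) :
    |coeffDiff α r n (k + 1) - coeffDiff α r n k| ≤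
      decayRate α r n * coeffDiff α r n k +
        (decayCoeff α r n (k + 1) - Real.exp (-decayRate α r n) * decayCoeff α r n k) := by
  have h1 := exp_neg_decayRate_mul_le hα hr0 hr1 hn k
  have h2 := coeffDiff_nonneg hα hr0 hr1 hn k
  have h3 := exp_neg_decayRate_lt_one hα hr0 hn
  have h4 := Real.add_one_le_exp (-decayRate α r n)
  have e : coeffDiff α r n (k + 1) - coeffDiff α r n k =
      (decayCoeff α r n (k + 1) - Real.exp (-decayRate α r n) * decayCoeff α r n k) -
        (1 - Real.exp (-decayRate α r n)) * coeffDiff α r n k := by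
    simp only [coeffDiff, pow_succ]; ring
  rw [e, abs_le]
  constructor <;> nlinarith

/-- Each of the two majorants contributes one `η`. If `S` is the sum of the coefficients, the terms
`c (k + 1) - exp (-δ) c k` add up to `(1 - exp (-δ)) S - 1 ≤ δ S - 1 ≤ η`. -/
lemma summable_abs_coeffDiff_sub {α r : ℝ} (hα : 0 < α) (hr0 : 0 < r) (hr1 : r < 1) {n : ℕ}
    (hn : 1 ≤ n) (hν : 1 < n * decayRate α r n) :
    Summable (fun k => |coeffDiff α r n (k + 1) - coeffDiff α r n k|) ∧
    ∑' k, |coeffDiff α r n (k + 1) - coeffDiff α r n k| ≤ 2 * modelError α r n := by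
  have hs := summable_decayCoeff hα hn hν
  have hs1 : Summable fun k => decayCoeff α r n (k + 1) := (summable_nat_add_iff 1).2 hs
  have hd := summable_coeffDiff hα hr0 hn hν
  have hmaj := (hd.mul_left (decayRate α r n)).add
    (hs1.sub (hs.mul_left (Real.exp (-decayRate α r n))))
  have hsum := Summable.of_nonneg_of_le (fun k => abs_nonneg _)
    (abs_coeffDiff_sub_le hα hr0 hr1 hn) hmaj
  refine ⟨hsum, (hsum.tsum_le_tsum (abs_coeffDiff_sub_le hα hr0 hr1 hn) hmaj).trans ?_⟩
  rw [(hd.mul_left _).tsum_add (hs1.sub (hs.mul_left _)), hs1.tsum_sub (hs.mul_left _),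
    tsum_mul_left, tsum_mul_left]
  have h1 := decayRate_mul_tsum_coeffDiff_le hα hr0 hn hν
  have h2 := decayRate_mul_tsum_le hα hr0 hn hν
  have h3 : ∑' k, decayCoeff α r n k = 1 + ∑' k, decayCoeff α r n (k + 1) := by
    rw [hs.tsum_eq_zero_add, decayCoeff_zero]
  have h4 := Real.add_one_le_exp (-decayRate α r n)
  have h5 : 0 ≤ ∑' k, decayCoeff α r n k := tsum_nonneg fun k => (decayCoeff_pos α r n k).le
  nlinarith

/-! ### The tail series and its geometric model -/

/-- The normalized tail `∑ exp (-α ((n + k) ^ r - n ^ r)) exp (i k t)` of the kernel. -/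
def tailSeries (α r : ℝ) (n : ℕ) (t : ℝ) : ℂ :=
  ∑' k : ℕ, (decayCoeff α r n k : ℂ) * Complex.exp (t * I) ^ k

/-- The sum of the geometric series with ratio `exp (-δ + i t)`. -/
def geomModel (δ t : ℝ) : ℂ := (1 - Complex.exp (-δ + t * I))⁻¹

lemma norm_exp_mul_I_pow (t : ℝ) (k : ℕ) : ‖Complex.exp (t * I) ^ k‖ = 1 := by
  rw [norm_pow, Complex.norm_exp_ofReal_mul_I, one_pow]

lemma norm_ofReal_mul_exp_pow (a t : ℝ) (k : ℕ) :
    ‖(a : ℂ) * Complex.exp (t * I) ^ k‖ = |a| := by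
  rw [norm_mul, norm_exp_mul_I_pow, mul_one, Complex.norm_real, Real.norm_eq_abs]

lemma summable_ofReal_mul_exp_pow {a : ℕ → ℝ} (ha : Summable fun k => |a k|) (t : ℝ) :
    Summable fun k => (a k : ℂ) * Complex.exp (t * I) ^ k :=
  Summable.of_norm (by simpa only [norm_ofReal_mul_exp_pow] using ha)

lemma norm_tsum_mul_exp_pow_le {a : ℕ → ℝ} (ha : Summable fun k => |a k|) (t : ℝ) :
    ‖∑' k, (a k : ℂ) * Complex.exp (t * I) ^ k‖ ≤ ∑' k, |a k| := by
  have h := norm_tsum_le_tsum_norm (f := fun k => (a k : ℂ) * Complex.exp (t * I) ^ k)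
    (by simpa only [norm_ofReal_mul_exp_pow] using ha)
  simpa only [norm_ofReal_mul_exp_pow] using h

lemma norm_exp_neg_add_mul_I (δ t : ℝ) : ‖Complex.exp (-δ + t * I)‖ = Real.exp (-δ) := by
  rw [Complex.norm_exp]; simp

lemma geomModel_eq_tsum {δ : ℝ} (hδ : 0 < δ) (t : ℝ) :
    HasSum (fun k : ℕ => ((Real.exp (-δ) ^ k : ℝ) : ℂ) * Complex.exp (t * I) ^ k)
      (geomModel δ t) := by
  have h : ‖Complex.exp (-δ + t * I)‖ < 1 := by
    rw [norm_exp_neg_add_mul_I, Real.exp_lt_one_iff]; linarith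
  have := hasSum_geometric_of_norm_lt_one h
  refine this.congr_fun fun k => ?_
  rw [Complex.exp_add, mul_pow]
  push_cast
  rfl

lemma tailSeries_sub_geomModel {α r : ℝ} (hα : 0 < α) (hr0 : 0 < r) {n : ℕ}
    (hn : 1 ≤ n) (hν : 1 < n * decayRate α r n) (t : ℝ) :
    tailSeries α r n t - geomModel (decayRate α r n) t =
      ∑' k, (coeffDiff α r n k : ℂ) * Complex.exp (t * I) ^ k := by
  have h1 := geomModel_eq_tsum (decayRate_pos hα hr0 hn) t
  have h2 : Summable fun k => (decayCoeff α r n k : ℂ) * Complex.exp (t * I) ^ k :=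
    summable_ofReal_mul_exp_pow (summable_decayCoeff hα hn hν).abs t
  rw [← h1.tsum_eq, tailSeries, ← h2.tsum_sub h1.summable]
  refine tsum_congr fun k => ?_
  rw [coeffDiff]; push_cast; ring

lemma decayRate_mul_norm_tailSeries_sub_le {α r : ℝ} (hα : 0 < α) (hr0 : 0 < r) (hr1 : r < 1)
    {n : ℕ} (hn : 1 ≤ n) (hν : 1 < n * decayRate α r n) (t : ℝ) :
    decayRate α r n * ‖tailSeries α r n t - geomModel (decayRate α r n) t‖ ≤
      modelError α r n := by
  rw [tailSeries_sub_geomModel hα hr0 hn hν]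
  refine le_trans ?_ (decayRate_mul_tsum_coeffDiff_le hα hr0 hn hν)
  have h := norm_tsum_mul_exp_pow_le (summable_coeffDiff hα hr0 hn hν).abs t
  simp only [abs_of_nonneg (coeffDiff_nonneg hα hr0 hr1 hn _)] at h
  have := decayRate_pos hα hr0 hn
  gcongr

/-- Summation by parts. -/
lemma one_sub_mul_tsum_pow {a : ℕ → ℂ} {w : ℂ} (ha : Summable fun k => a k * w ^ k)
    (h0 : a 0 = 0) :
    (1 - w) * ∑' k, a k * w ^ k = w * ∑' k, (a (k + 1) - a k) * w ^ k := by
  have h1 : ∑' k, a k * w ^ k = ∑' k, a (k + 1) * w ^ (k + 1) := by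
    rw [ha.tsum_eq_zero_add, h0]; simp
  have hs : Summable fun k => a (k + 1) * w ^ (k + 1) :=
    (summable_nat_add_iff (f := fun k => a k * w ^ k) 1).2 ha
  have h2 : w * ∑' k, (a (k + 1) - a k) * w ^ k =
      ∑' k, (a (k + 1) * w ^ (k + 1) - w * (a k * w ^ k)) := by
    rw [← tsum_mul_left]
    refine tsum_congr fun k => ?_
    rw [pow_succ]; ring
  rw [h2, hs.tsum_sub (ha.mul_left w), tsum_mul_left, ← h1]
  ring

/-- Summation by parts trades the sum of the coefficient differences for their variation. There is
no boundary term, because both sequences start at `1`. -/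
lemma norm_one_sub_mul_tailSeries_sub_le {α r : ℝ} (hα : 0 < α) (hr0 : 0 < r) (hr1 : r < 1)
    {n : ℕ} (hn : 1 ≤ n) (hν : 1 < n * decayRate α r n) (t : ℝ) :
    ‖1 - Complex.exp (t * I)‖ * ‖tailSeries α r n t - geomModel (decayRate α r n) t‖ ≤
      2 * modelError α r n := by
  obtain ⟨hs, hle⟩ := summable_abs_coeffDiff_sub hα hr0 hr1 hn hν
  rw [tailSeries_sub_geomModel hα hr0 hn hν, ← norm_mul,
    one_sub_mul_tsum_pow (a := fun k => (coeffDiff α r n k : ℂ))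
      (summable_ofReal_mul_exp_pow (summable_coeffDiff hα hr0 hn hν).abs t)
      (by simp [coeffDiff, decayCoeff_zero]), norm_mul, Complex.norm_exp_ofReal_mul_I, one_mul]
  refine le_trans ?_ hle
  simp only [← Complex.ofReal_sub]
  exact norm_tsum_mul_exp_pow_le hs t

lemma abs_le_norm_one_sub_exp {t : ℝ} (ht : |t| ≤ π) :
    2 * |t| ≤ π * ‖1 - Complex.exp (t * I)‖ := by
  rw [norm_sub_rev, mul_comm (t : ℂ), Complex.norm_exp_I_mul_ofReal_sub_one, norm_mul,
    Real.norm_eq_abs, Real.norm_eq_abs, abs_two]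
  have h := Real.mul_abs_le_abs_sin (x := t / 2) (by rw [abs_div, abs_two]; linarith)
  rw [abs_div, abs_two] at h
  have hp := Real.pi_pos
  have e : 2 * |t| = π * (2 * (2 / π * (|t| / 2))) := by field_simp
  rw [e]; gcongr

/-- The uniform bound `η / δ` is effective for `|t| ≤ δ` and the bound by variation, of order `η /
|t|`, beyond. Adding squares gives the factor `1 + π² ≤ 16`. -/
lemma norm_tailSeries_sub_mul_sqrt_le {α r : ℝ} (hα : 0 < α) (hr0 : 0 < r) (hr1 : r < 1)
    {n : ℕ} (hn : 1 ≤ n) (hν : 1 < n * decayRate α r n) {t : ℝ} (ht : |t| ≤ π) :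
    ‖tailSeries α r n t - geomModel (decayRate α r n) t‖ ≤
      4 * modelError α r n * (√(decayRate α r n ^ 2 + t ^ 2))⁻¹ := by
  have h1 := decayRate_mul_norm_tailSeries_sub_le hα hr0 hr1 hn hν t
  have h2 := norm_one_sub_mul_tailSeries_sub_le hα hr0 hr1 hn hν t
  have h3 := abs_le_norm_one_sub_exp ht
  have hδ := decayRate_pos hα hr0 hn
  have hη : 0 < modelError α r n := by
    have : 0 < n * decayRate α r n - 1 := by linarith
    unfold modelError; positivity
  set y := ‖tailSeries α r n t - geomModel (decayRate α r n) t‖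
  set δ := decayRate α r n
  set η := modelError α r n
  have hy : 0 ≤ y := norm_nonneg _
  have h4 : |t| * y ≤ π * η := by nlinarith [Real.pi_pos]
  have hp := Real.pi_lt_d2
  have hp0 := Real.pi_pos
  have h5 : (δ * y) ^ 2 ≤ η ^ 2 := by gcongr
  have h6 : (|t| * y) ^ 2 ≤ (π * η) ^ 2 := by gcongr
  have h7 : π ^ 2 ≤ 15 := by nlinarith
  rw [mul_pow, sq_abs] at h6
  have hs : 0 < √(δ ^ 2 + t ^ 2) := by positivity
  rw [← div_eq_mul_inv, le_div_iff₀ hs]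
  apply le_of_sq_le_sq _ (by positivity)
  rw [mul_pow, Real.sq_sqrt (by positivity)]
  nlinarith [sq_nonneg η]

/-! ### Size and regularity of the geometric model -/

section model

variable {δ : ℝ}

lemma mul_le_one_sub_exp_neg (hδ : 0 < δ) (hδ1 : δ ≤ 1 / 14) :
    14 / 15 * δ ≤ 1 - Real.exp (-δ) := by
  have h1 := Real.add_one_le_exp δ
  have h2 : Real.exp (-δ) * Real.exp δ = 1 := by rw [← Real.exp_add]; simp
  have h3 := Real.exp_pos (-δ)
  have h4 : Real.exp (-δ) * (1 + δ) ≤ 1 := by nlinarith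
  nlinarith

lemma norm_one_sub_exp_ge (hδ : 0 < δ) (hδ1 : δ ≤ 1 / 14) (t : ℝ) :
    δ / 2 ≤ ‖1 - Complex.exp (-δ + t * I)‖ := by
  have h := norm_sub_norm_le (1 : ℂ) (Complex.exp (-δ + t * I))
  rw [norm_exp_neg_add_mul_I, norm_one] at h
  linarith [mul_le_one_sub_exp_neg hδ hδ1]

lemma norm_geomModel_le (hδ : 0 < δ) (hδ1 : δ ≤ 1 / 14) (t : ℝ) : ‖geomModel δ t‖ ≤ 2 / δ := by
  rw [geomModel, norm_inv, ← inv_div]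
  exact inv_anti₀ (by positivity) (norm_one_sub_exp_ge hδ hδ1 t)

lemma one_sub_exp_ne_zero (hδ : 0 < δ) (hδ1 : δ ≤ 1 / 14) (t : ℝ) :
    1 - Complex.exp (-δ + t * I) ≠ 0 := by
  rw [← norm_pos_iff]
  linarith [norm_one_sub_exp_ge hδ hδ1 t]

/-- The squared modulus is `(1 - exp (-δ))² + 2 exp (-δ) (1 - cos t)`; its two terms control `δ²`
and `t²` respectively. -/
lemma sqrt_le_two_mul_norm (hδ : 0 < δ) (hδ1 : δ ≤ 1 / 14) {t : ℝ} (ht : |t| ≤ π) :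
    √(δ ^ 2 + t ^ 2) ≤ 2 * ‖1 - Complex.exp (-δ + t * I)‖ := by
  have h1 := mul_le_one_sub_exp_neg hδ hδ1
  have h2 := Real.cos_le_one_sub_mul_cos_sq ht
  have h3 := Real.add_one_le_exp (-δ)
  have e : ‖1 - Complex.exp (-δ + t * I)‖ ^ 2 =
      (1 - Real.exp (-δ)) ^ 2 + 2 * Real.exp (-δ) * (1 - Real.cos t) := by
    rw [Complex.sq_norm, Complex.normSq_apply]
    have e1 : Complex.exp (-δ + t * I) = Complex.exp (((-δ : ℝ) : ℂ) + t * I) := by push_cast; rfl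
    rw [e1]
    simp only [Complex.sub_re, Complex.sub_im, Complex.exp_re, Complex.exp_im, Complex.one_re,
      Complex.one_im, Complex.add_re, Complex.add_im, Complex.ofReal_re, Complex.ofReal_im,
      Complex.mul_re, Complex.mul_im, Complex.I_re, Complex.I_im]
    ring_nf
    nlinarith [Real.sin_sq_add_cos_sq t]
  apply Real.sqrt_le_iff.2 ⟨by positivity, ?_⟩
  rw [mul_pow, e]
  have hp : π ^ 2 ≤ 10 := by nlinarith [Real.pi_lt_d2, Real.pi_pos]
  have h4 : t ^ 2 / 5 ≤ 1 - Real.cos t := by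
    have : 1 / 5 ≤ 2 / π ^ 2 := by
      rw [div_le_div_iff₀ (by norm_num) (by positivity)]; linarith
    nlinarith [sq_nonneg t]
  have h5 : (14 / 15 * δ) ^ 2 ≤ (1 - Real.exp (-δ)) ^ 2 := by gcongr
  nlinarith [sq_nonneg t]

lemma norm_geomModel_le_inv_sqrt (hδ : 0 < δ) (hδ1 : δ ≤ 1 / 14) {t : ℝ} (ht : |t| ≤ π) :
    ‖geomModel δ t‖ ≤ 2 * (√(δ ^ 2 + t ^ 2))⁻¹ := by
  have hs : 0 < √(δ ^ 2 + t ^ 2) := by positivity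
  have h := sqrt_le_two_mul_norm hδ hδ1 ht
  rw [geomModel, norm_inv, ← div_eq_mul_inv, inv_le_iff_one_le_mul₀ (by linarith)]
  rw [div_mul_eq_mul_div, one_le_div hs]
  exact h

/-- A resolvent identity: the difference contains the product of the two values, one of which is
bounded by `2 / δ`. The other is kept, so that the oscillation is measured relative to the amplitude
itself. -/
lemma norm_geomModel_add_sub_le (hδ : 0 < δ) (hδ1 : δ ≤ 1 / 14) (t h : ℝ) :
    ‖geomModel δ (t + h) - geomModel δ t‖ ≤ |h| * (2 / δ) * ‖geomModel δ t‖ := by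
  have e : geomModel δ (t + h) - geomModel δ t =
      Complex.exp (-δ + t * I) * (Complex.exp (I * h) - 1) * geomModel δ (t + h) *
        geomModel δ t := by
    have h1 := one_sub_exp_ne_zero hδ hδ1 t
    have h2 := one_sub_exp_ne_zero hδ hδ1 (t + h)
    have h3 : Complex.exp (-δ + (t + h : ℝ) * I) =
        Complex.exp (-δ + t * I) * Complex.exp (I * h) := by
      rw [← Complex.exp_add]; congr 1; push_cast; ring
    simp only [geomModel]
    rw [h3] at h2 ⊢
    field_simp
    ring
  rw [e, norm_mul, norm_mul, norm_mul, norm_exp_neg_add_mul_I]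
  have h1 : Real.exp (-δ) ≤ 1 := Real.exp_le_one_iff.2 (by linarith)
  have h2 := Real.norm_exp_I_mul_ofReal_sub_one_le (x := h)
  rw [Real.norm_eq_abs] at h2
  have h3 := norm_geomModel_le hδ hδ1 (t + h)
  calc _ ≤ 1 * |h| * (2 / δ) * ‖geomModel δ t‖ := by gcongr
    _ = _ := by ring

/-- With `z = δ - i t`, the function `1 / (1 - exp (-z)) - 1 / z` has a removable singularity at
`0`. Taylor's bound serves for `‖z‖ ≤ 1`, and for larger `z` each term is bounded separately. -/
lemma norm_geomModel_sub_inv_le (hδ : 0 < δ) (hδ1 : δ ≤ 1 / 14) {t : ℝ} (ht : |t| ≤ π) :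
    ‖geomModel δ t - (δ - t * I)⁻¹‖ ≤ 3 := by
  have hz : ‖(δ - t * I : ℂ)‖ = √(δ ^ 2 + t ^ 2) := by
    rw [← Real.sqrt_sq (norm_nonneg _), Complex.sq_norm, Complex.normSq_apply]
    congr 1; simp; ring
  have hs : 0 < √(δ ^ 2 + t ^ 2) := by positivity
  have h1 := sqrt_le_two_mul_norm hδ hδ1 ht
  have h0 := one_sub_exp_ne_zero hδ hδ1 t
  rw [← hz] at h1 hs
  have hexp : (-δ + t * I : ℂ) = -(δ - t * I) := by ring
  simp only [geomModel]
  rw [hexp] at h0 h1 ⊢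
  set z : ℂ := δ - t * I with hzd
  have hz0 : z ≠ 0 := norm_pos_iff.1 hs
  have hx := norm_pos_iff.2 h0
  rcases le_or_gt ‖z‖ 1 with hle | hgt
  · have e : (1 - Complex.exp (-z))⁻¹ - z⁻¹ =
        (Complex.exp (-z) - 1 - -z) / ((1 - Complex.exp (-z)) * z) := by
      field_simp; ring
    have h2 := Complex.norm_exp_sub_one_sub_id_le (x := -z) (by rwa [norm_neg])
    rw [norm_neg] at h2
    rw [e, norm_div, norm_mul, div_le_iff₀ (by positivity)]
    nlinarith
  · have h2 := norm_sub_le (1 - Complex.exp (-z))⁻¹ z⁻¹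
    rw [norm_inv, norm_inv] at h2
    have h3 : ‖z‖⁻¹ ≤ 1 := inv_le_one_of_one_le₀ hgt.le
    have h4 : ‖1 - Complex.exp (-z)‖⁻¹ ≤ 2 := by
      rw [inv_le_comm₀ hx (by norm_num)]; linarith
    linarith

end model

/-! ### The tail of the kernel as a cosine series -/

/-- `∑_{k ≥ n} exp (-α k ^ r) cos (k t - β π / 2)`. -/
def tailKernel (α r β : ℝ) (n : ℕ) (t : ℝ) : ℝ :=
  Real.exp (-α * (n : ℝ) ^ r) *
    (Complex.exp ((n * t - β * π / 2 : ℝ) * I) * tailSeries α r n t).re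

lemma exp_mul_decayCoeff (α r : ℝ) (n k : ℕ) :
    Real.exp (-α * (n : ℝ) ^ r) * decayCoeff α r n k =
      Real.exp (-α * ((n + k : ℕ) : ℝ) ^ r) := by
  rw [decayCoeff, ← Real.exp_add]; congr 1; ring

lemma tailKernel_eq_tsum {α r : ℝ} (hα : 0 < α) (β : ℝ) {n : ℕ}
    (hn : 1 ≤ n) (hν : 1 < n * decayRate α r n) (t : ℝ) :
    tailKernel α r β n t = ∑' k : ℕ, Real.exp (-α * ((n + k : ℕ) : ℝ) ^ r) *
      Real.cos (((n + k : ℕ) : ℝ) * t - β * π / 2) := by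
  have hs : Summable fun k => (decayCoeff α r n k : ℂ) * Complex.exp (t * I) ^ k :=
    summable_ofReal_mul_exp_pow (summable_decayCoeff hα hn hν).abs t
  have h1 := (Complex.hasSum_re
    (hs.hasSum.mul_left (Complex.exp ((n * t - β * π / 2 : ℝ) * I)))).mul_left
      (Real.exp (-α * (n : ℝ) ^ r))
  rw [tailKernel, tailSeries, ← h1.tsum_eq]
  refine tsum_congr fun k => ?_
  have e : Complex.exp ((n * t - β * π / 2 : ℝ) * I) *
      ((decayCoeff α r n k : ℂ) * Complex.exp (t * I) ^ k) =
      (decayCoeff α r n k : ℂ) *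
        Complex.exp ((((n + k : ℕ) : ℝ) * t - β * π / 2 : ℝ) * I) := by
    rw [← Complex.exp_nat_mul, mul_left_comm, ← Complex.exp_add]
    congr 2; push_cast; ring
  rw [e, Complex.re_ofReal_mul, Complex.exp_ofReal_mul_I_re, ← mul_assoc, exp_mul_decayCoeff]

lemma summable_exp_neg_rpow {α r : ℝ} (hα : 0 < α) {n : ℕ}
    (hn : 1 ≤ n) (hν : 1 < n * decayRate α r n) :
    Summable fun k : ℕ => Real.exp (-α * ((n + k : ℕ) : ℝ) ^ r) := by
  simp only [← exp_mul_decayCoeff]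
  exact (summable_decayCoeff hα hn hν).mul_left _

lemma summable_exp_neg_succ_rpow {α r : ℝ} (hα : 0 < α) {n : ℕ}
    (hn : 1 ≤ n) (hν : 1 < n * decayRate α r n) :
    Summable fun k : ℕ => Real.exp (-α * ((k + 1 : ℕ) : ℝ) ^ r) := by
  have h := summable_exp_neg_rpow hα hn hν
  rw [← summable_nat_add_iff (n - 1)]
  refine h.congr fun k => ?_
  congr 4; omega

/-! ### Termwise integration of convolutions -/

section convolution

variable {φ : ℝ → ℝ}

lemma intervalIntegrable_cos_mul (hφ : IntervalIntegrable φ volume (-π) π) (u v : ℝ) :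
    IntervalIntegrable (fun t => Real.cos (u * t + v) * φ t) volume (-π) π :=
  hφ.continuousOn_mul (by fun_prop)

lemma hasSum_integral_cos_mul (hφ : IntervalIntegrable φ volume (-π) π) {a : ℕ → ℝ}
    (ha : Summable fun k => |a k|) (m : ℕ → ℝ) (b x : ℝ) :
    HasSum (fun k => a k * ∫ t in (-π)..π, Real.cos (m k * (x - t) - b) * φ t)
      (∫ t in (-π)..π, (∑' k, a k * Real.cos (m k * (x - t) - b)) * φ t) := by
  have h := intervalIntegral.hasSum_integral_of_dominated_convergence
    (μ := volume) (a := -π) (b := π)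
    (F := fun k t => a k * (Real.cos (m k * (x - t) - b) * φ t))
    (f := fun t => (∑' k, a k * Real.cos (m k * (x - t) - b)) * φ t)
    (fun k t => |a k| * |φ t|) ?_ ?_ ?_ ?_ ?_
  · simpa only [intervalIntegral.integral_const_mul] using h
  · intro k
    have hc : Continuous fun t => Real.cos (m k * (x - t) - b) := by fun_prop
    exact (hc.aestronglyMeasurable.mul hφ.def'.aestronglyMeasurable).const_mul _
  · refine fun k => Filter.Eventually.of_forall fun t _ => ?_
    rw [Real.norm_eq_abs, abs_mul, abs_mul]
    have := Real.abs_cos_le_one (m k * (x - t) - b)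
    have h2 : |Real.cos (m k * (x - t) - b)| * |φ t| ≤ 1 * |φ t| := by gcongr
    rw [one_mul] at h2
    gcongr
  · exact Filter.Eventually.of_forall fun t _ => ha.mul_right _
  · simp only [tsum_mul_right]
    exact hφ.abs.const_mul _
  · refine Filter.Eventually.of_forall fun t _ => ?_
    have hs : Summable fun k => a k * Real.cos (m k * (x - t) - b) := by
      refine Summable.of_norm_bounded ha fun k => ?_
      rw [Real.norm_eq_abs, abs_mul]
      exact mul_le_of_le_one_right (abs_nonneg _) (Real.abs_cos_le_one _)
    simpa only [mul_assoc] using hs.hasSum.mul_right (φ t)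

/-- Separates `x` from `t`. The sine coefficient is written as a cosine with phase moved by `π / 2`,
so that one family of integrals covers both coefficients. -/
lemma integral_cos_sub_mul (hφ : IntervalIntegrable φ volume (-π) π) (m b x : ℝ) :
    ∫ t in (-π)..π, Real.cos (m * (x - t) - b) * φ t =
      (∫ t in (-π)..π, Real.cos (m * t + b) * φ t) * Real.cos (m * x) +
        (∫ t in (-π)..π, Real.cos (m * t + (b - π / 2)) * φ t) * Real.sin (m * x) := by
  rw [← intervalIntegral.integral_mul_const, ← intervalIntegral.integral_mul_const,
    ← intervalIntegral.integral_add ((intervalIntegrable_cos_mul hφ m b).mul_const _)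
      ((intervalIntegrable_cos_mul hφ m (b - π / 2)).mul_const _)]
  refine intervalIntegral.integral_congr fun t _ => ?_
  have e : m * (x - t) - b = m * x - (m * t + b) := by ring
  have e2 : m * t + (b - π / 2) = (m * t + b) - π / 2 := by ring
  simp only [e, e2, Real.cos_sub_pi_div_two]
  rw [Real.cos_sub]
  ring

lemma abs_integral_cos_mul_le (hφ : IntervalIntegrable φ volume (-π) π) (u v : ℝ) :
    |∫ t in (-π)..π, Real.cos (u * t + v) * φ t| ≤ ∫ t in (-π)..π, |φ t| := by
  have hp : -π ≤ π := by linarith [Real.pi_pos]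
  refine (intervalIntegral.abs_integral_le_integral_abs hp).trans ?_
  refine intervalIntegral.integral_mono_on hp (intervalIntegrable_cos_mul hφ u v).abs hφ.abs
    fun t _ => ?_
  rw [abs_mul]
  exact mul_le_of_le_one_left (abs_nonneg _) (Real.abs_cos_le_one _)

end convolution

/-! ### Fourier coefficients of absolutely convergent trigonometric series -/

section trigSeries

lemma integral_cos_int_mul_add {m : ℝ} (hm : ∃ k : ℤ, m = k) (hm0 : m ≠ 0) (c : ℝ) :
    ∫ x in (-π)..π, Real.cos (m * x + c) = 0 := by
  obtain ⟨k, rfl⟩ := hm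
  rw [intervalIntegral.integral_comp_mul_add (fun x => Real.cos x) hm0, integral_cos]
  have : (k : ℝ) * π + c = ((k : ℝ) * -π + c) + k * (2 * π) := by ring
  rw [this, Real.sin_add_int_mul_two_pi, sub_self, smul_zero]

lemma integral_cos_mul_cos {k j : ℕ} (hk : 1 ≤ k) (c d : ℝ) :
    ∫ x in (-π)..π, Real.cos (k * x + c) * Real.cos (j * x + d) =
      if k = j then π * Real.cos (c - d) else 0 := by
  have e : ∀ x : ℝ, Real.cos (k * x + c) * Real.cos (j * x + d) =
      1 / 2 * Real.cos (((k : ℝ) - j) * x + (c - d)) +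
        1 / 2 * Real.cos (((k : ℝ) + j) * x + (c + d)) := fun x => by
    have h1 : ((k : ℝ) - j) * x + (c - d) = (k * x + c) - (j * x + d) := by ring
    have h2 : ((k : ℝ) + j) * x + (c + d) = (k * x + c) + (j * x + d) := by ring
    rw [h1, h2, Real.cos_sub (k * x + c), Real.cos_add (k * x + c)]; ring
  simp only [e]
  have hk' : (1 : ℝ) ≤ k := by exact_mod_cast hk
  rw [intervalIntegral.integral_add
    (Continuous.intervalIntegrable (by fun_prop) _ _)
    (Continuous.intervalIntegrable (by fun_prop) _ _),
    intervalIntegral.integral_const_mul, intervalIntegral.integral_const_mul,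
    integral_cos_int_mul_add (m := (k : ℝ) + j) ⟨k + j, by push_cast; ring⟩ (by positivity)]
  split_ifs with h
  · subst h
    simp
    ring
  · rw [integral_cos_int_mul_add (m := (k : ℝ) - j) ⟨k - j, by push_cast; ring⟩
      (sub_ne_zero.2 (by exact_mod_cast h))]
    simp

variable {A B : ℕ → ℝ} {a₀ : ℝ} {f : ℝ → ℝ}

lemma norm_trig_term_le (a b u : ℝ) : ‖a * Real.cos u + b * Real.sin u‖ ≤ |a| + |b| := by
  refine (norm_add_le _ _).trans ?_
  rw [Real.norm_eq_abs, Real.norm_eq_abs, abs_mul, abs_mul]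
  exact add_le_add (mul_le_of_le_one_right (abs_nonneg _) (Real.abs_cos_le_one _))
    (mul_le_of_le_one_right (abs_nonneg _) (Real.abs_sin_le_one _))

lemma summable_trigSeries (hA : Summable fun k => |A k|) (hB : Summable fun k => |B k|)
    (x : ℝ) : Summable fun k : ℕ => A k * Real.cos (((k + 1 : ℕ) : ℝ) * x) +
      B k * Real.sin (((k + 1 : ℕ) : ℝ) * x) :=
  Summable.of_norm_bounded (hA.add hB) fun _ => norm_trig_term_le _ _ _

lemma integral_trig_term_mul_cos (a b : ℝ) (k j : ℕ) (d : ℝ) :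
    ∫ x in (-π)..π, (a * Real.cos (((k + 1 : ℕ) : ℝ) * x) +
      b * Real.sin (((k + 1 : ℕ) : ℝ) * x)) * Real.cos (j * x + d) =
      if k + 1 = j then π * (a * Real.cos d - b * Real.sin d) else 0 := by
  have e : ∀ x : ℝ, (a * Real.cos (((k + 1 : ℕ) : ℝ) * x) +
      b * Real.sin (((k + 1 : ℕ) : ℝ) * x)) * Real.cos (j * x + d) =
      a * (Real.cos (((k + 1 : ℕ) : ℝ) * x + 0) * Real.cos (j * x + d)) +
      b * (Real.cos (((k + 1 : ℕ) : ℝ) * x + -(π / 2)) * Real.cos (j * x + d)) := fun x => by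
    rw [← sub_eq_add_neg, Real.cos_sub_pi_div_two, add_zero]; ring
  simp only [e]
  rw [intervalIntegral.integral_add
    (Continuous.intervalIntegrable (by fun_prop) _ _)
    (Continuous.intervalIntegrable (by fun_prop) _ _),
    intervalIntegral.integral_const_mul, intervalIntegral.integral_const_mul,
    integral_cos_mul_cos (by omega), integral_cos_mul_cos (by omega)]
  have e2 : Real.cos (-(π / 2) - d) = -Real.sin d := by
    rw [← Real.cos_neg, ← Real.cos_add_pi_div_two]; congr 1; ring
  split_ifs
  · rw [e2, zero_sub, Real.cos_neg]; ring
  · simp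

/-- The free phase `d` treats both kinds of coefficient at once: `d = 0` yields the cosine ones and
`d = -π / 2` the sine ones. -/
lemma integral_trigSeries_mul_cos (hA : Summable fun k => |A k|) (hB : Summable fun k => |B k|)
    (hf : ∀ x : ℝ, f x = a₀ / 2 + ∑' k : ℕ, (A k * Real.cos (((k + 1 : ℕ) : ℝ) * x) +
      B k * Real.sin (((k + 1 : ℕ) : ℝ) * x))) (j : ℕ) (d : ℝ) :
    ∫ x in (-π)..π, f x * Real.cos (j * x + d) =
      (a₀ / 2 * ∫ x in (-π)..π, Real.cos (j * x + d)) +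
        ∑' k : ℕ, if k + 1 = j then π * (A k * Real.cos d - B k * Real.sin d) else 0 := by
  have hc : Continuous fun x : ℝ => ∑' k : ℕ, (A k * Real.cos (((k + 1 : ℕ) : ℝ) * x) +
      B k * Real.sin (((k + 1 : ℕ) : ℝ) * x)) :=
    continuous_tsum (fun k => by fun_prop) (hA.add hB) fun k x => norm_trig_term_le _ _ _
  have h := intervalIntegral.hasSum_integral_of_dominated_convergence
    (μ := volume) (a := -π) (b := π)
    (F := fun k x => (A k * Real.cos (((k + 1 : ℕ) : ℝ) * x) +
      B k * Real.sin (((k + 1 : ℕ) : ℝ) * x)) * Real.cos (j * x + d))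
    (f := fun x => (∑' k : ℕ, (A k * Real.cos (((k + 1 : ℕ) : ℝ) * x) +
      B k * Real.sin (((k + 1 : ℕ) : ℝ) * x))) * Real.cos (j * x + d))
    (fun k _ => |A k| + |B k|)
    (fun k => Continuous.aestronglyMeasurable (by fun_prop))
    (fun k => Filter.Eventually.of_forall fun x _ => ?_)
    (Filter.Eventually.of_forall fun x _ => hA.add hB)
    intervalIntegrable_const
    (Filter.Eventually.of_forall fun x _ => (summable_trigSeries hA hB x).hasSum.mul_right _)
  · simp only [integral_trig_term_mul_cos] at h
    rw [h.tsum_eq]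
    simp only [hf, add_mul]
    rw [intervalIntegral.integral_add (Continuous.intervalIntegrable (by fun_prop) _ _)
      (Continuous.intervalIntegrable (by fun_prop) _ _), intervalIntegral.integral_const_mul]
  · rw [norm_mul]
    exact (mul_le_of_le_one_right (norm_nonneg _) (Real.abs_cos_le_one _)).trans
      (norm_trig_term_le _ _ _)

lemma cosCoeff_zero_trigSeries (hA : Summable fun k => |A k|) (hB : Summable fun k => |B k|)
    (hf : ∀ x : ℝ, f x = a₀ / 2 + ∑' k : ℕ, (A k * Real.cos (((k + 1 : ℕ) : ℝ) * x) +
      B k * Real.sin (((k + 1 : ℕ) : ℝ) * x))) : cosCoeff f 0 = a₀ := by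
  have h := integral_trigSeries_mul_cos hA hB hf 0 0
  simp at h
  simp [cosCoeff, h]
  field_simp
  ring

lemma integral_trigSeries_mul_cos_succ (hA : Summable fun k => |A k|)
    (hB : Summable fun k => |B k|)
    (hf : ∀ x : ℝ, f x = a₀ / 2 + ∑' k : ℕ, (A k * Real.cos (((k + 1 : ℕ) : ℝ) * x) +
      B k * Real.sin (((k + 1 : ℕ) : ℝ) * x))) (j : ℕ) (d : ℝ) :
    ∫ x in (-π)..π, f x * Real.cos ((j + 1 : ℕ) * x + d) =
      π * (A j * Real.cos d - B j * Real.sin d) := by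
  rw [integral_trigSeries_mul_cos hA hB hf,
    integral_cos_int_mul_add ⟨(j + 1 : ℕ), by push_cast; rfl⟩ (by positivity), mul_zero, zero_add,
    tsum_eq_single j (by intro k hk; simp [hk])]
  simp

lemma cosCoeff_succ_trigSeries (hA : Summable fun k => |A k|) (hB : Summable fun k => |B k|)
    (hf : ∀ x : ℝ, f x = a₀ / 2 + ∑' k : ℕ, (A k * Real.cos (((k + 1 : ℕ) : ℝ) * x) +
      B k * Real.sin (((k + 1 : ℕ) : ℝ) * x))) (j : ℕ) : cosCoeff f (j + 1) = A j := by
  have h := integral_trigSeries_mul_cos_succ hA hB hf j 0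
  simp only [add_zero] at h
  rw [cosCoeff, h, Real.cos_zero, Real.sin_zero]
  have := Real.pi_ne_zero
  field_simp
  ring

lemma sinCoeff_succ_trigSeries (hA : Summable fun k => |A k|) (hB : Summable fun k => |B k|)
    (hf : ∀ x : ℝ, f x = a₀ / 2 + ∑' k : ℕ, (A k * Real.cos (((k + 1 : ℕ) : ℝ) * x) +
      B k * Real.sin (((k + 1 : ℕ) : ℝ) * x))) (j : ℕ) : sinCoeff f (j + 1) = B j := by
  have h := integral_trigSeries_mul_cos_succ hA hB hf j (-(π / 2))
  simp only [← sub_eq_add_neg, Real.cos_sub_pi_div_two] at h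
  rw [sinCoeff, h, Real.cos_neg, Real.sin_neg, Real.cos_pi_div_two, Real.sin_pi_div_two]
  have := Real.pi_ne_zero
  field_simp
  ring

lemma sub_fourierSum_trigSeries (hA : Summable fun k => |A k|) (hB : Summable fun k => |B k|)
    (hf : ∀ x : ℝ, f x = a₀ / 2 + ∑' k : ℕ, (A k * Real.cos (((k + 1 : ℕ) : ℝ) * x) +
      B k * Real.sin (((k + 1 : ℕ) : ℝ) * x))) (m : ℕ) (x : ℝ) :
    f x - fourierSum f m x = ∑' k : ℕ, (A (k + m) * Real.cos (((k + m + 1 : ℕ) : ℝ) * x) +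
      B (k + m) * Real.sin (((k + m + 1 : ℕ) : ℝ) * x)) := by
  have h := (summable_trigSeries hA hB x).sum_add_tsum_nat_add m
  have e : fourierSum f m x = a₀ / 2 + ∑ k ∈ Finset.range m,
      (A k * Real.cos (((k + 1 : ℕ) : ℝ) * x) + B k * Real.sin (((k + 1 : ℕ) : ℝ) * x)) := by
    rw [fourierSum, cosCoeff_zero_trigSeries hA hB hf, ← Finset.Ico_succ_right_eq_Icc,
      Finset.sum_Ico_eq_sum_range]
    congr 1
    refine Finset.sum_congr (by simp) fun k _ => ?_
    rw [add_comm 1 k, cosCoeff_succ_trigSeries hA hB hf, sinCoeff_succ_trigSeries hA hB hf]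
  rw [hf, e, ← h]
  ring

end trigSeries

/-! ### The remainder as a convolution with the tail -/

/-- The deviation of a generalized Poisson integral from its partial Fourier sum is the
convolution with the tail of the kernel. -/
lemma sub_fourierSum_eq {α r β : ℝ} (hα : 0 < α) {n : ℕ} (hn : 1 ≤ n)
    (hν : 1 < n * decayRate α r n) {φ f : ℝ → ℝ} (hφ : IntervalIntegrable φ volume (-π) π)
    {a₀ : ℝ} (hf : ∀ x : ℝ,
      f x = a₀ / 2 + 1 / π * ∫ t in (-π)..π, poissonKernel α r β (x - t) * φ t) (x : ℝ) :
    f x - fourierSum f (n - 1) x =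
      1 / π * ∫ t in (-π)..π, tailKernel α r β n (x - t) * φ t := by
  set a : ℕ → ℝ := fun k => Real.exp (-α * ((k + 1 : ℕ) : ℝ) ^ r) with ha
  set U : ℕ → ℝ := fun k =>
    ∫ t in (-π)..π, Real.cos (((k + 1 : ℕ) : ℝ) * t + β * π / 2) * φ t with hU
  set V : ℕ → ℝ := fun k =>
    ∫ t in (-π)..π, Real.cos (((k + 1 : ℕ) : ℝ) * t + (β * π / 2 - π / 2)) * φ t with hV
  have hs : Summable a := summable_exp_neg_succ_rpow hα hn hν
  have hbd : ∀ W : ℕ → ℝ, (∀ k, |W k| ≤ ∫ t in (-π)..π, |φ t|) →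
      Summable fun k => |1 / π * (a k * W k)| := fun W hW => by
    refine Summable.of_nonneg_of_le (fun _ => abs_nonneg _) (fun k => ?_)
      (hs.mul_left (1 / π * ∫ t in (-π)..π, |φ t|))
    have hak : 0 < a k := Real.exp_pos _
    have := Real.pi_pos
    rw [abs_mul, abs_mul, abs_of_pos hak, abs_of_pos (by positivity : 0 < 1 / π)]
    calc 1 / π * (a k * |W k|) ≤ 1 / π * (a k * ∫ t in (-π)..π, |φ t|) := by
          gcongr; exact hW k
      _ = _ := by ring
  have hA := hbd U fun k => abs_integral_cos_mul_le hφ _ _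
  have hB := hbd V fun k => abs_integral_cos_mul_le hφ _ _
  have hf' : ∀ x : ℝ, f x = a₀ / 2 + ∑' k : ℕ,
      (1 / π * (a k * U k) * Real.cos (((k + 1 : ℕ) : ℝ) * x) +
        1 / π * (a k * V k) * Real.sin (((k + 1 : ℕ) : ℝ) * x)) := fun x => by
    rw [hf]
    congr 1
    simp only [poissonKernel]
    rw [← (hasSum_integral_cos_mul hφ hs.abs (fun k => ((k + 1 : ℕ) : ℝ)) (β * π / 2) x).tsum_eq,
      ← tsum_mul_left]
    refine tsum_congr fun k => ?_
    rw [integral_cos_sub_mul hφ]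
    simp only [hU, hV]
    ring
  rw [sub_fourierSum_trigSeries hA hB hf']
  simp only [tailKernel_eq_tsum hα β hn hν]
  rw [← (hasSum_integral_cos_mul hφ (summable_exp_neg_rpow hα hn hν).abs
    (fun k => ((n + k : ℕ) : ℝ)) (β * π / 2) x).tsum_eq, ← tsum_mul_left]
  refine tsum_congr fun k => ?_
  rw [integral_cos_sub_mul hφ]
  -- Removing the orders up to `n - 1` leaves exactly the frequencies from `n` on; the truncated
  -- subtraction is harmless because `1 ≤ n`.
  have e : k + (n - 1) + 1 = n + k := by omega
  simp only [ha, hU, hV, e]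
  ring

/-! ### Norms over a period -/

/-- The `L_q` norm over `(-π, π]`, as a real number. -/
def circleNorm (q : ℝ) (f : ℝ → ℝ) : ℝ := (∫ t in (-π)..π, |f t| ^ q) ^ (1 / q)

lemma neg_pi_le_pi : -π ≤ π := by linarith [Real.pi_pos]

section circleNorm

variable {q : ℝ} {f g : ℝ → ℝ}

lemma integral_abs_rpow_nonneg (q : ℝ) (f : ℝ → ℝ) : 0 ≤ ∫ t in (-π)..π, |f t| ^ q :=
  intervalIntegral.integral_nonneg neg_pi_le_pi fun _ _ => by positivity

lemma circleNorm_nonneg (q : ℝ) (f : ℝ → ℝ) : 0 ≤ circleNorm q f :=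
  Real.rpow_nonneg (integral_abs_rpow_nonneg q f) _

lemma circleNorm_rpow (hq : 0 < q) (f : ℝ → ℝ) :
    circleNorm q f ^ q = ∫ t in (-π)..π, |f t| ^ q := by
  rw [circleNorm, ← Real.rpow_mul (integral_abs_rpow_nonneg q f), one_div_mul_cancel hq.ne',
    Real.rpow_one]

lemma continuous_abs_rpow (hq : 0 < q) (hf : Continuous f) : Continuous fun t => |f t| ^ q :=
  hf.abs.rpow_const fun _ => Or.inr hq.le

lemma memLp_restrict_Ioc (hf : Continuous f) (p : ℝ≥0∞) :
    MemLp f p (volume.restrict (Ioc (-π) π)) := by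
  obtain ⟨C, hC⟩ := isCompact_Icc.exists_bound_of_continuousOn (s := Icc (-π) π) hf.continuousOn
  refine MemLp.of_bound hf.aestronglyMeasurable C ?_
  exact (ae_restrict_iff' measurableSet_Ioc).2
    (Filter.Eventually.of_forall fun t ht => hC t (Ioc_subset_Icc_self ht))

lemma eLpNorm_eq_circleNorm (hq : 0 < q) (hf : Continuous f) :
    eLpNorm f (ENNReal.ofReal q) (volume.restrict (Ioc (-π) π)) =
      ENNReal.ofReal (circleNorm q f) := by
  rw [(memLp_restrict_Ioc hf _).eLpNorm_eq_integral_rpow_norm (by simpa using hq)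
    ENNReal.ofReal_ne_top, ENNReal.toReal_ofReal hq.le, circleNorm,
    intervalIntegral.integral_of_le neg_pi_le_pi, one_div]
  simp only [Real.norm_eq_abs]

lemma circleNorm_add_le (hq : 1 ≤ q) (hf : Continuous f) (hg : Continuous g) :
    circleNorm q (fun t => f t + g t) ≤ circleNorm q f + circleNorm q g := by
  have hq0 : 0 < q := by linarith
  have h := eLpNorm_add_le (μ := volume.restrict (Ioc (-π) π)) (p := ENNReal.ofReal q)
    hf.aestronglyMeasurable hg.aestronglyMeasurable (by simpa using hq)
  have hfg : Continuous (f + g) := hf.add hg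
  rw [eLpNorm_eq_circleNorm hq0 hf, eLpNorm_eq_circleNorm hq0 hg, eLpNorm_eq_circleNorm hq0 hfg,
    ← ENNReal.ofReal_add (circleNorm_nonneg _ _) (circleNorm_nonneg _ _)] at h
  exact (ENNReal.ofReal_le_ofReal_iff
    (add_nonneg (circleNorm_nonneg _ _) (circleNorm_nonneg _ _))).1 h

lemma circleNorm_mono (hq : 0 < q) (hf : Continuous f) (hg : Continuous g)
    (h : ∀ t, |t| ≤ π → |f t| ≤ |g t|) : circleNorm q f ≤ circleNorm q g := by
  refine Real.rpow_le_rpow (integral_abs_rpow_nonneg _ _) ?_ (by positivity)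
  refine intervalIntegral.integral_mono_on neg_pi_le_pi
    ((continuous_abs_rpow hq hf).intervalIntegrable _ _)
    ((continuous_abs_rpow hq hg).intervalIntegrable _ _) fun t ht => ?_
  exact Real.rpow_le_rpow (abs_nonneg _) (h t (abs_le.2 ht)) hq.le

lemma circleNorm_const_mul (hq : 0 < q) (c : ℝ) (f : ℝ → ℝ) :
    circleNorm q (fun t => c * f t) = |c| * circleNorm q f := by
  simp only [circleNorm, abs_mul, Real.mul_rpow (abs_nonneg _) (abs_nonneg _)]
  rw [intervalIntegral.integral_const_mul, Real.mul_rpow (by positivity)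
    (integral_abs_rpow_nonneg q f), ← Real.rpow_mul (abs_nonneg c), mul_one_div_cancel hq.ne',
    Real.rpow_one]

lemma circleNorm_le_of_abs_le (hq : 1 ≤ q) (hf : Continuous f) {C : ℝ}
    (h : ∀ t, |t| ≤ π → |f t| ≤ C) : circleNorm q f ≤ C * (2 * π) ^ (1 / q) := by
  have hC : 0 ≤ C := (abs_nonneg _).trans (h 0 (by simpa using Real.pi_pos.le))
  have h1 := circleNorm_mono (q := q) (by linarith) hf (continuous_const (y := C))
    (by simpa only [abs_of_nonneg hC] using h)
  refine h1.trans (le_of_eq ?_)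
  have h2 := Real.rpow_nonneg hC q
  have hp := Real.pi_pos
  simp only [circleNorm, intervalIntegral.integral_const, abs_of_nonneg hC, smul_eq_mul]
  rw [Real.mul_rpow (by linarith) h2, ← Real.rpow_mul hC, mul_one_div_cancel (by linarith),
    Real.rpow_one, mul_comm]
  congr 2; ring

lemma integral_comp_add_right_of_periodic {F : ℝ → ℝ} (hF : Function.Periodic F (2 * π)) (h : ℝ) :
    ∫ t in (-π)..π, F (t + h) = ∫ t in (-π)..π, F t := by
  rw [intervalIntegral.integral_comp_add_right]
  have := hF.intervalIntegral_add_eq (-π + h) (-π)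
  convert this using 2 <;> ring

lemma circleNorm_comp_add (hf : Function.Periodic f (2 * π)) (h : ℝ) :
    circleNorm q (fun t => f (t + h)) = circleNorm q f := by
  rw [circleNorm, circleNorm]
  congr 1
  exact integral_comp_add_right_of_periodic (F := fun t => |f t| ^ q)
    (fun t => by simp only [hf t]) h

lemma circleNorm_comp_neg (f : ℝ → ℝ) :
    circleNorm q (fun t => f (-t)) = circleNorm q f := by
  rw [circleNorm, circleNorm, intervalIntegral.integral_comp_neg (fun t => |f t| ^ q), neg_neg]

lemma circleNorm_sub_le (hq : 1 ≤ q) (hf : Continuous f) (hg : Continuous g) :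
    circleNorm q (fun t => f t - g t) ≤ circleNorm q f + circleNorm q g := by
  have h := circleNorm_add_le (g := fun t => -g t) hq hf hg.neg
  have e : circleNorm q (fun t => -g t) = circleNorm q g := by simp [circleNorm]
  rw [e] at h
  simpa only [← sub_eq_add_neg] using h

lemma abs_circleNorm_sub_le (hq : 1 ≤ q) (hf : Continuous f) (hg : Continuous g) :
    |circleNorm q f - circleNorm q g| ≤ circleNorm q (fun t => f t - g t) := by
  have h1 := circleNorm_add_le (f := fun t => f t - g t) hq (hf.sub hg) hg
  have h2 := circleNorm_sub_le (g := fun t => f t - g t) hq hf (hf.sub hg)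
  simp only [sub_add_cancel, sub_sub_cancel] at h1 h2
  rw [abs_le]
  constructor <;> linarith

/-- Integrals over `[0, 2π)` and `(-π, π]` of a periodic function agree. -/
lemma setIntegral_Ico_eq (hf : Function.Periodic f (2 * π)) :
    ∫ t in Ico 0 (2 * π), f t = ∫ t in (-π)..π, f t := by
  have hp := Real.pi_pos
  have h := hf.intervalIntegral_add_eq (-π) 0
  rw [integral_Ico_eq_integral_Ioc, ← intervalIntegral.integral_of_le (by linarith)]
  have e : -π + 2 * π = π := by ring
  rw [e, zero_add] at h
  exact h.symm

lemma memLp_restrict_Ico (hf : Continuous f) (p : ℝ≥0∞) :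
    MemLp f p (volume.restrict (Ico 0 (2 * π))) := by
  obtain ⟨C, hC⟩ := isCompact_Icc.exists_bound_of_continuousOn (s := Icc 0 (2 * π))
    hf.continuousOn
  refine MemLp.of_bound hf.aestronglyMeasurable C ?_
  exact (ae_restrict_iff' measurableSet_Ico).2
    (Filter.Eventually.of_forall fun t ht => hC t (Ico_subset_Icc_self ht))

lemma periodNorm_eq (hq : 0 < q) (hf : Continuous f) (hper : Function.Periodic f (2 * π)) :
    periodNorm (ENNReal.ofReal q) f = ENNReal.ofReal (circleNorm q f) := by
  rw [periodNorm, (memLp_restrict_Ico hf _).eLpNorm_eq_integral_rpow_norm (by simpa using hq)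
    ENNReal.ofReal_ne_top, ENNReal.toReal_ofReal hq.le, circleNorm, one_div]
  congr 2
  exact setIntegral_Ico_eq (f := fun t => |f t| ^ q) fun t => by simp only [hper t]

end circleNorm

/-! ### Hölder's inequality and its extremal functions -/

section holder

variable {p q : ℝ} {φ u : ℝ → ℝ}

lemma integrableOn_of_mem_zeroMeanBall {p : ℝ≥0∞} (hp : 1 ≤ p) (hφ : φ ∈ zeroMeanBall p) :
    IntegrableOn φ (Ico 0 (2 * π)) := by
  have hmem : MemLp φ p (volume.restrict (Ico 0 (2 * π))) :=
    ⟨hφ.2.1, hφ.2.2.1.trans_lt ENNReal.one_lt_top⟩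
  exact hmem.integrable hp

lemma intervalIntegrable_of_mem_zeroMeanBall {p : ℝ≥0∞} (hp : 1 ≤ p) (hφ : φ ∈ zeroMeanBall p) :
    IntervalIntegrable φ volume (-π) π := by
  have hpi := Real.pi_pos
  have h := integrableOn_of_mem_zeroMeanBall hp hφ
  have h1 : IntervalIntegrable φ volume 0 (0 + 2 * π) := by
    rw [zero_add, intervalIntegrable_iff_integrableOn_Ico_of_le (by linarith)]
    exact h
  exact hφ.1.intervalIntegrable (by linarith) h1 _ _

lemma setIntegral_Ico_abs_eq_integral (hu : Function.Periodic u (2 * π)) (x : ℝ) :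
    ∫ t in Ico 0 (2 * π), |u (x - t)| ^ q = ∫ t in (-π)..π, |u t| ^ q := by
  rw [setIntegral_Ico_eq (f := fun t => |u (x - t)| ^ q)
    fun t => by simp only [hu.sub_eq, ← sub_sub]]
  have h := intervalIntegral.integral_comp_neg (a := -π) (b := π) (fun t => |u (t + x)| ^ q)
  rw [neg_neg, integral_comp_add_right_of_periodic (F := fun t => |u t| ^ q)
    fun t => by simp only [hu t]] at h
  rw [← h]
  refine intervalIntegral.integral_congr fun t _ => ?_
  simp only [sub_eq_add_neg, add_comm]

lemma abs_integral_conv_le (hpq : p.HolderConjugate q) (hu : Continuous u)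
    (hper : Function.Periodic u (2 * π)) (hφ : φ ∈ zeroMeanBall (ENNReal.ofReal p)) (x : ℝ) :
    |∫ t in (-π)..π, u (x - t) * φ t| ≤ circleNorm q u := by
  have hmem : MemLp φ (ENNReal.ofReal p) (volume.restrict (Ico 0 (2 * π))) :=
    ⟨hφ.2.1, hφ.2.2.1.trans_lt ENNReal.one_lt_top⟩
  have hux : Continuous fun t => u (x - t) := by fun_prop
  rw [← setIntegral_Ico_eq (f := fun t => u (x - t) * φ t)
    fun t => by simp only [hφ.1 t, hper.sub_eq, ← sub_sub]]
  refine (abs_integral_le_integral_abs).trans ?_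
  have h := integral_mul_norm_le_Lp_mul_Lq hpq.symm
    (memLp_restrict_Ico hux (ENNReal.ofReal q)) hmem
  simp only [Real.norm_eq_abs] at h
  simp only [abs_mul]
  refine h.trans ?_
  rw [setIntegral_Ico_abs_eq_integral hper, ← circleNorm]
  refine mul_le_of_le_one_right (circleNorm_nonneg _ _) ?_
  have h1 := hφ.2.2.1
  rw [periodNorm, hmem.eLpNorm_eq_integral_rpow_norm (by simpa using hpq.pos)
    ENNReal.ofReal_ne_top, ENNReal.toReal_ofReal hpq.nonneg, ENNReal.ofReal_le_one] at h1
  simpa only [one_div, Real.norm_eq_abs] using h1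

lemma abs_integral_conv_le_of_abs_le (hper : Function.Periodic u (2 * π))
    {C : ℝ} (hC : ∀ t, |u t| ≤ C) (hφ : φ ∈ zeroMeanBall 1) (x : ℝ) :
    |∫ t in (-π)..π, u (x - t) * φ t| ≤ C := by
  have hC0 : 0 ≤ C := (abs_nonneg _).trans (hC 0)
  have hint := integrableOn_of_mem_zeroMeanBall le_rfl hφ
  rw [← setIntegral_Ico_eq (f := fun t => u (x - t) * φ t)
    fun t => by simp only [hφ.1 t, hper.sub_eq, ← sub_sub]]
  have h1 : ∫ t in Ico 0 (2 * π), ‖φ t‖ ≤ 1 := by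
    have h := hφ.2.2.1
    rw [periodNorm, eLpNorm_one_eq_lintegral_enorm] at h
    rw [integral_norm_eq_lintegral_enorm hint.aestronglyMeasurable]
    exact ENNReal.toReal_le_of_le_ofReal zero_le_one (by simpa using h)
  have h2 : ‖∫ t in Ico 0 (2 * π), u (x - t) * φ t‖ ≤ ∫ t in Ico 0 (2 * π), C * ‖φ t‖ := by
    refine norm_integral_le_of_norm_le (hint.norm.const_mul C)
      (Filter.Eventually.of_forall fun t => ?_)
    rw [norm_mul]
    exact mul_le_mul_of_nonneg_right (hC _) (norm_nonneg _)
  rw [integral_const_mul] at h2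
  rw [← Real.norm_eq_abs]
  nlinarith

/-- A norming functional for a continuous function. -/
lemma exists_norming (hpq : p.HolderConjugate q) (hu : Continuous u)
    (hper : Function.Periodic u (2 * π)) :
    ∃ ψ : ℝ → ℝ, Continuous ψ ∧ Function.Periodic ψ (2 * π) ∧ circleNorm p ψ ≤ 1 ∧
      ∫ t in (-π)..π, u t * ψ t = circleNorm q u := by
  have hq1 : 0 < q - 1 := by linarith [hpq.symm.lt]
  have hq0 : 0 < q := hpq.symm.pos
  have hp0 : 0 < p := hpq.pos
  set N := circleNorm q u with hN
  rcases (circleNorm_nonneg q u).eq_or_lt with h0 | h0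
  · refine ⟨0, continuous_zero, fun _ => rfl, ?_, ?_⟩
    · simp [circleNorm, hp0.ne']
    · simp [hN, ← h0]
  · rw [← hN] at h0
    -- This is `sign u · |u| ^ (q - 1)`, normalized; splitting into positive and negative parts
    -- makes its continuity evident, since `q > 1`.
    set ψ : ℝ → ℝ := fun t =>
      (max (u t) 0 ^ (q - 1) - max (-u t) 0 ^ (q - 1)) / N ^ (q - 1) with hψ
    have hmul : ∀ t, u t * ψ t = |u t| ^ q / N ^ (q - 1) := fun t => by
      simp only [hψ]
      rcases le_total 0 (u t) with h | h
      · rw [max_eq_left h, max_eq_right (by linarith), Real.zero_rpow hq1.ne', abs_of_nonneg h,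
          sub_zero, ← mul_div_assoc]
        congr 1
        rcases h.eq_or_lt with h' | h'
        · rw [← h', Real.zero_rpow hq0.ne', zero_mul]
        · rw [Real.rpow_sub_one h'.ne']; field_simp
      · rw [max_eq_right h, max_eq_left (by linarith), Real.zero_rpow hq1.ne', abs_of_nonpos h,
          zero_sub, ← mul_div_assoc]
        congr 1
        rcases h.eq_or_lt with h' | h'
        · rw [h', neg_zero, Real.zero_rpow hq0.ne', zero_mul]
        · rw [Real.rpow_sub_one (by linarith)]; have := h'.ne; field_simp
    have habs : ∀ t, |ψ t| ^ p = |u t| ^ q / N ^ q := fun t => by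
      have e : |ψ t| = |u t| ^ (q - 1) / N ^ (q - 1) := by
        simp only [hψ]
        rw [abs_div, abs_of_pos (Real.rpow_pos_of_pos h0 _)]
        congr 1
        rcases le_total 0 (u t) with h | h
        · rw [max_eq_left h, max_eq_right (by linarith), Real.zero_rpow hq1.ne',
            abs_of_nonneg h, sub_zero, abs_of_nonneg (by positivity)]
        · rw [max_eq_right h, max_eq_left (by linarith), Real.zero_rpow hq1.ne',
            abs_of_nonpos h, zero_sub, abs_neg,
            abs_of_nonneg (Real.rpow_nonneg (by linarith) _)]
      have e2 : (q - 1) * p = q := by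
        have := hpq.sub_one_mul_conj
        have := hpq.mul_eq_add
        nlinarith
      rw [e, Real.div_rpow (by positivity) (by positivity), ← Real.rpow_mul (abs_nonneg _),
        ← Real.rpow_mul h0.le, e2]
    have hNq : N ^ q = ∫ t in (-π)..π, |u t| ^ q := circleNorm_rpow hq0 u
    refine ⟨ψ, ?_, ?_, ?_, ?_⟩
    · have h1 : Continuous fun t => max (u t) 0 ^ (q - 1) :=
        (hu.max continuous_const).rpow_const fun _ => Or.inr hq1.le
      have h2 : Continuous fun t => max (-u t) 0 ^ (q - 1) :=
        (hu.neg.max continuous_const).rpow_const fun _ => Or.inr hq1.le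
      exact (h1.sub h2).div_const _
    · intro t; simp only [hψ, hper t]
    · rw [circleNorm]
      simp only [habs]
      rw [intervalIntegral.integral_div, ← hNq, div_self (Real.rpow_pos_of_pos h0 _).ne',
        Real.one_rpow]
    · simp only [hmul]
      rw [intervalIntegral.integral_div, ← hNq, Real.rpow_sub_one h0.ne']
      field_simp

end holder

/-! ### Modulated amplitudes -/

lemma exp_mul_I_periodic : Function.Periodic (fun t : ℝ => Complex.exp (t * I)) (2 * π) :=
  fun t => by
    have e : ((t + 2 * π : ℝ) : ℂ) * I = t * I + 2 * π * I := by push_cast; ring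
    simp only [e, Complex.exp_periodic (t * I)]

lemma tailSeries_periodic (α r : ℝ) (n : ℕ) : Function.Periodic (tailSeries α r n) (2 * π) :=
  fun t => by
    have e : Complex.exp ((t + 2 * π : ℝ) * I) = Complex.exp (t * I) := exp_mul_I_periodic t
    simp only [tailSeries, e]

lemma continuous_tailSeries {α r : ℝ} (hα : 0 < α) {n : ℕ}
    (hn : 1 ≤ n) (hν : 1 < n * decayRate α r n) : Continuous (tailSeries α r n) :=
  continuous_tsum (fun k => by fun_prop) (summable_decayCoeff hα hn hν).abs
    fun k t => (norm_ofReal_mul_exp_pow _ t k).le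

lemma geomModel_periodic (δ : ℝ) : Function.Periodic (geomModel δ) (2 * π) := fun t => by
  have e : Complex.exp ((t + 2 * π : ℝ) * I) = Complex.exp (t * I) := exp_mul_I_periodic t
  simp only [geomModel, Complex.exp_add, e]

lemma continuous_geomModel {δ : ℝ} (hδ : 0 < δ) (hδ1 : δ ≤ 1 / 14) : Continuous (geomModel δ) :=
  Continuous.inv₀ (by fun_prop) fun t => one_sub_exp_ne_zero hδ hδ1 t

/-- The real part of `exp (i (n t - b)) g t`. -/
def modulate (n : ℕ) (b : ℝ) (g : ℝ → ℂ) (t : ℝ) : ℝ :=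
  (Complex.exp ((n * t - b : ℝ) * I) * g t).re

lemma tailKernel_eq_modulate (α r β : ℝ) (n : ℕ) (t : ℝ) :
    tailKernel α r β n t = Real.exp (-α * (n : ℝ) ^ r) *
      modulate n (β * π / 2) (tailSeries α r n) t := rfl

lemma continuous_modulate {g : ℝ → ℂ} (hg : Continuous g) (n : ℕ) (b : ℝ) :
    Continuous (modulate n b g) := by
  unfold modulate; fun_prop

lemma modulate_periodic {g : ℝ → ℂ} (hg : Function.Periodic g (2 * π)) (n : ℕ) (b : ℝ) :
    Function.Periodic (modulate n b g) (2 * π) := fun t => by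
  have e : Complex.exp ((n * (t + 2 * π) - b : ℝ) * I) = Complex.exp ((n * t - b : ℝ) * I) := by
    rw [Complex.exp_eq_exp_iff_exists_int]
    exact ⟨n, by push_cast; ring⟩
  simp only [modulate, e, hg t]

lemma abs_modulate_le (n : ℕ) (b : ℝ) (g : ℝ → ℂ) (t : ℝ) : |modulate n b g t| ≤ ‖g t‖ := by
  refine (Complex.abs_re_le_norm _).trans ?_
  rw [norm_mul, Complex.norm_exp_ofReal_mul_I, one_mul]

lemma modulate_sub (n : ℕ) (b : ℝ) (g h : ℝ → ℂ) (t : ℝ) :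
    modulate n b g t - modulate n b h t = modulate n b (fun t => g t - h t) t := by
  simp only [modulate, mul_sub, Complex.sub_re]

lemma modulate_add_div {n : ℕ} (hn : 1 ≤ n) (b s : ℝ) (g : ℝ → ℂ) (t : ℝ) :
    modulate n b g (t + s / n) = modulate n (b - s) (fun t => g (t + s / n)) t := by
  have h : (n : ℝ) ≠ 0 := by positivity
  have e : n * (t + s / n) - b = n * t - (b - s) := by field_simp; ring
  simp only [modulate, e]

lemma modulate_sub_pi (n : ℕ) (b : ℝ) (g : ℝ → ℂ) (t : ℝ) :
    modulate n (b - π) g t = - modulate n b g t := by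
  have e : ((n * t - (b - π) : ℝ) : ℂ) * I = (n * t - b : ℝ) * I + π * I := by push_cast; ring
  simp only [modulate, e, Complex.exp_add, Complex.exp_pi_mul_I]
  simp

/-! ### Averaging over the phase of the carrier -/

section averaging

variable {q : ℝ} {g : ℝ → ℂ}

/-- At a fixed point the argument of the amplitude is only another shift of the phase, and the
integral over a full period does not see it. -/
lemma integral_abs_modulate_phase (n : ℕ) (b t : ℝ) (g : ℝ → ℂ) (hq : 0 < q) :
    ∫ s in (-π)..π, |modulate n (b - s) g t| ^ q = circleNorm q Real.cos ^ q * ‖g t‖ ^ q := by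
  have e : ∀ s, |modulate n (b - s) g t| ^ q =
      |Real.cos (s + (n * t - b + Complex.arg (g t)))| ^ q * ‖g t‖ ^ q := fun s => by
    have e1 : modulate n (b - s) g t =
        ‖g t‖ * Real.cos (s + (n * t - b + Complex.arg (g t))) := by
      rw [modulate, ← Complex.norm_mul_exp_arg_mul_I (g t), mul_left_comm, ← Complex.exp_add,
        Complex.re_ofReal_mul, ← add_mul, ← Complex.ofReal_add, Complex.exp_ofReal_mul_I_re]
      rw [Complex.norm_mul_exp_arg_mul_I]
      congr 2; ring
    rw [e1, abs_mul, abs_of_nonneg (norm_nonneg _),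
      Real.mul_rpow (norm_nonneg _) (abs_nonneg _), mul_comm]
  simp only [e]
  rw [intervalIntegral.integral_mul_const, circleNorm_rpow hq,
    integral_comp_add_right_of_periodic (F := fun s => |Real.cos s| ^ q)
      fun s => by simp only [Real.cos_add_two_pi]]

lemma integral_circleNorm_modulate_rpow (hq : 0 < q) (n : ℕ) (b : ℝ) (hg : Continuous g) :
    ∫ s in (-π)..π, circleNorm q (modulate n (b - s) g) ^ q =
      (circleNorm q Real.cos * circleNorm q fun t => ‖g t‖) ^ q := by
  simp only [circleNorm_rpow hq]
  have hc : Continuous fun z : ℝ × ℝ => |modulate n (b - z.1) g z.2| ^ q := by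
    refine Continuous.rpow_const ?_ fun _ => Or.inr hq.le
    unfold modulate; fun_prop
  rw [intervalIntegral_intervalIntegral_swap]
  swap
  · refine (hc.continuousOn.integrableOn_compact
      ((isCompact_Icc (a := -π) (b := π)).prod (isCompact_Icc (a := -π) (b := π)))).mono_set ?_
    rw [uIoc_of_le neg_pi_le_pi]
    exact prod_mono Ioc_subset_Icc_self Ioc_subset_Icc_self
  simp only [integral_abs_modulate_phase n b _ g hq]
  rw [intervalIntegral.integral_const_mul, Real.mul_rpow (circleNorm_nonneg _ _)
    (circleNorm_nonneg _ _), circleNorm_rpow hq (fun t => ‖g t‖)]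
  simp only [abs_norm]

/-- The norm of a modulated function is, up to the oscillation of its amplitude over a period of
the modulation, the norm of the amplitude times the normalized norm of the cosine. -/
lemma abs_circleNorm_modulate_sub_le (hq : 1 ≤ q) {n : ℕ} (hn : 1 ≤ n) (b : ℝ)
    (hg : Continuous g) (hper : Function.Periodic g (2 * π)) {ω : ℝ}
    (hω : ∀ s, |s| ≤ π → circleNorm q (fun t => ‖g (t + s / n) - g t‖) ≤ ω) :
    |circleNorm q (modulate n b g) -
      circleNorm q Real.cos / (2 * π) ^ (1 / q) * circleNorm q (fun t => ‖g t‖)| ≤ ω := by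
  have hq0 : 0 < q := by linarith
  have hpi := Real.pi_pos
  have hω0 : 0 ≤ ω := (circleNorm_nonneg _ _).trans (hω 0 (by simpa using hpi.le))
  set N := circleNorm q (modulate n b g) with hN
  set A := circleNorm q Real.cos * circleNorm q (fun t => ‖g t‖) with hA
  have hA0 : 0 ≤ A := mul_nonneg (circleNorm_nonneg _ _) (circleNorm_nonneg _ _)
  have hN0 : 0 ≤ N := circleNorm_nonneg _ _
  -- Translation by `s / n` preserves the norm and acts as the phase change `b ↦ b - s` together
  -- with a small shift of the amplitude.
  have hshift : ∀ s, |s| ≤ π → |N - circleNorm q (modulate n (b - s) g)| ≤ ω := fun s hs => by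
    rw [hN, ← circleNorm_comp_add (modulate_periodic hper n b) (s / n)]
    simp only [modulate_add_div hn]
    refine (abs_circleNorm_sub_le hq (continuous_modulate (by fun_prop) n _)
      (continuous_modulate hg n _)).trans ((circleNorm_mono hq0 ?_ ?_ ?_).trans (hω s hs))
    · exact (continuous_modulate (by fun_prop) n _).sub (continuous_modulate hg n _)
    · fun_prop
    · intro t _
      rw [modulate_sub, abs_norm]
      exact abs_modulate_le _ _ _ _
  have hint := integral_circleNorm_modulate_rpow (g := g) hq0 n b hg
  have hcont : Continuous fun s => circleNorm q (modulate n (b - s) g) ^ q := by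
    simp only [circleNorm_rpow hq0]
    refine intervalIntegral.continuous_parametric_intervalIntegral_of_continuous' ?_ _ _
    refine Continuous.rpow_const ?_ fun _ => Or.inr hq0.le
    unfold modulate; fun_prop
  have hroot : ∀ c : ℝ, 0 ≤ c → (∫ s in (-π)..π, c ^ q) ^ (1 / q) = (2 * π) ^ (1 / q) * c :=
    fun c hc => by
      rw [intervalIntegral.integral_const, smul_eq_mul,
        Real.mul_rpow (by linarith) (Real.rpow_nonneg hc _), ← Real.rpow_mul hc,
        mul_one_div_cancel hq0.ne', Real.rpow_one]
      congr 2; ring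
  have hA' : (A ^ q) ^ (1 / q) = A := by
    rw [← Real.rpow_mul hA0, mul_one_div_cancel hq0.ne', Real.rpow_one]
  have h2pi : 0 < (2 * π) ^ (1 / q) := by positivity
  -- The phase average of the `q`-th powers equals `A ^ q`, while every norm in it lies within `ω`
  -- of `N`; comparison with constants bounds `A` from both sides.
  have hup : A ≤ (2 * π) ^ (1 / q) * (N + ω) := by
    rw [← hA', ← hroot _ (by linarith), ← hint]
    refine Real.rpow_le_rpow (hint ▸ Real.rpow_nonneg hA0 _) ?_ (by positivity)
    refine intervalIntegral.integral_mono_on neg_pi_le_pi (hcont.intervalIntegrable _ _)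
      intervalIntegrable_const fun s hs => ?_
    refine Real.rpow_le_rpow (circleNorm_nonneg _ _) ?_ hq0.le
    linarith [(abs_le.1 (hshift s (abs_le.2 hs))).1]
  have hlow : (2 * π) ^ (1 / q) * (N - ω) ≤ A := by
    rcases le_or_gt (N - ω) 0 with h | h
    · exact (mul_nonpos_of_nonneg_of_nonpos h2pi.le h).trans hA0
    · rw [← hA', ← hroot _ h.le, ← hint]
      refine Real.rpow_le_rpow (intervalIntegral.integral_nonneg neg_pi_le_pi
        fun _ _ => by positivity) ?_ (by positivity)
      refine intervalIntegral.integral_mono_on neg_pi_le_pi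
        intervalIntegrable_const (hcont.intervalIntegrable _ _) fun s hs => ?_
      refine Real.rpow_le_rpow h.le ?_ hq0.le
      linarith [(abs_le.1 (hshift s (abs_le.2 hs))).2]
  rw [div_mul_eq_mul_div, ← hA, abs_le]
  constructor
  · have := (div_le_iff₀' h2pi).2 hup
    linarith
  · have := (le_div_iff₀' h2pi).2 hlow
    linarith

end averaging

/-! ### Upper and lower bounds for the deviation by duality -/

lemma tailKernel_periodic (α r β : ℝ) (n : ℕ) : Function.Periodic (tailKernel α r β n) (2 * π) :=
  fun t => by
    simp only [tailKernel_eq_modulate, modulate_periodic (tailSeries_periodic α r n) n _ t]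

lemma continuous_tailKernel {α r : ℝ} (hα : 0 < α) (β : ℝ) {n : ℕ}
    (hn : 1 ≤ n) (hν : 1 < n * decayRate α r n) : Continuous (tailKernel α r β n) := by
  simp only [funext (tailKernel_eq_modulate α r β n)]
  exact (continuous_modulate (continuous_tailSeries hα hn hν) n _).const_mul _

lemma poissonKernel_periodic (α r β : ℝ) : Function.Periodic (poissonKernel α r β) (2 * π) :=
  fun t => by
    simp only [poissonKernel]
    refine tsum_congr fun k => ?_
    have e : ((k + 1 : ℕ) : ℝ) * (t + 2 * π) - β * π / 2 =
        ((k + 1 : ℕ) : ℝ) * t - β * π / 2 + ((k + 1 : ℕ) : ℝ) * (2 * π) := by ring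
    rw [e, Real.cos_add_nat_mul_two_pi]

section deviation

variable {α r β : ℝ} {n : ℕ}

lemma fourierDeviation_le (hα : 0 < α) (hn : 1 ≤ n) (hν : 1 < n * decayRate α r n) {p : ℝ≥0∞}
    (hp : 1 ≤ p) {M : ℝ} (hM : ∀ φ ∈ zeroMeanBall p, ∀ x,
      |∫ t in (-π)..π, tailKernel α r β n (x - t) * φ t| ≤ M) :
    fourierDeviation α r β p n ≤ ((1 / π * M : ℝ) : EReal) := by
  refine iSup₂_le fun f hf => iSup_le fun x => EReal.coe_le_coe_iff.2 ?_
  obtain ⟨-, a₀, φ, hφ, hfφ⟩ := hf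
  beta_reduce
  rw [sub_fourierSum_eq hα hn hν (intervalIntegrable_of_mem_zeroMeanBall hp hφ) hfφ, abs_mul,
    abs_of_pos (one_div_pos.2 Real.pi_pos)]
  have := Real.pi_pos
  gcongr
  exact hM φ hφ x

lemma le_fourierDeviation (hα : 0 < α) (hn : 1 ≤ n) (hν : 1 < n * decayRate α r n) {p : ℝ≥0∞}
    (hp : 1 ≤ p) {φ : ℝ → ℝ} (hφ : φ ∈ zeroMeanBall p) (x : ℝ) :
    ((1 / π * ∫ t in (-π)..π, tailKernel α r β n (x - t) * φ t : ℝ) : EReal) ≤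
      fourierDeviation α r β p n := by
  set f : ℝ → ℝ := fun x => 0 / 2 + 1 / π * ∫ t in (-π)..π, poissonKernel α r β (x - t) * φ t
    with hf
  have hmem : f ∈ poissonClass α r β p := by
    refine ⟨fun x => ?_, 0, φ, hφ, fun x => rfl⟩
    have e : ∀ t, x + 2 * π - t = x - t + 2 * π := fun t => by ring
    simp only [hf, e, poissonKernel_periodic α r β _]
  refine le_trans ?_ (le_iSup₂_of_le f hmem (le_iSup (fun x =>
    ((|f x - fourierSum f (n - 1) x| : ℝ) : EReal)) x))
  rw [sub_fourierSum_eq hα hn hν (intervalIntegrable_of_mem_zeroMeanBall hp hφ) (a₀ := 0)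
    (f := f) (β := β) fun x => rfl]
  exact EReal.coe_le_coe_iff.2 (le_abs_self _)

/-- Subtracting a translate kills the mean, and the factor `1 / 2` restores the norm bound. This
admits test functions of arbitrary mean. -/
lemma difference_mem_zeroMeanBall {p : ℝ} (hp : 1 ≤ p) {ψ : ℝ → ℝ} (hc : Continuous ψ)
    (hper : Function.Periodic ψ (2 * π)) (hnorm : circleNorm p ψ ≤ 1) (h : ℝ) :
    (fun t => 1 / 2 * (ψ t - ψ (t + h))) ∈ zeroMeanBall (ENNReal.ofReal p) := by
  have hc' : Continuous fun t => 1 / 2 * (ψ t - ψ (t + h)) := by fun_prop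
  have hper' : Function.Periodic (fun t => 1 / 2 * (ψ t - ψ (t + h))) (2 * π) := fun t => by
    have e : t + 2 * π + h = t + h + 2 * π := by ring
    simp only [e, hper _]
  refine ⟨hper', hc'.aestronglyMeasurable, ?_, ?_⟩
  · rw [periodNorm_eq (by linarith) hc' hper', ENNReal.ofReal_le_one,
      circleNorm_const_mul (by linarith)]
    have h1 := circleNorm_sub_le (g := fun t => ψ (t + h)) hp hc (by fun_prop)
    rw [circleNorm_comp_add hper] at h1
    rw [abs_of_pos (by norm_num)]
    linarith
  · rw [setIntegral_Ico_eq hper', intervalIntegral.integral_const_mul,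
      intervalIntegral.integral_sub (hc.intervalIntegrable _ _)
        (Continuous.intervalIntegrable (by fun_prop) _ _),
      integral_comp_add_right_of_periodic hper, sub_self, mul_zero]

/-- A change of variable moves the translation from the test function to the kernel. -/
lemma le_fourierDeviation_of_test (hα : 0 < α) (hn : 1 ≤ n) (hν : 1 < n * decayRate α r n)
    {p : ℝ} (hp : 1 ≤ p) {ψ : ℝ → ℝ} (hc : Continuous ψ)
    (hper : Function.Periodic ψ (2 * π)) (hnorm : circleNorm p ψ ≤ 1) (x h : ℝ) :
    ((1 / π * (1 / 2 * ∫ t in (-π)..π,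
      (tailKernel α r β n (x - t) - tailKernel α r β n (x + h - t)) * ψ t) : ℝ) : EReal) ≤
      fourierDeviation α r β (ENNReal.ofReal p) n := by
  refine le_trans (le_of_eq ?_) (le_fourierDeviation (β := β) hα hn hν (by simpa using hp)
    (difference_mem_zeroMeanBall hp hc hper hnorm h) x)
  have hQ := continuous_tailKernel hα β hn hν
  congr 2
  rw [← intervalIntegral.integral_const_mul]
  have h1 : ∫ t in (-π)..π, tailKernel α r β n (x + h - t) * ψ t =
      ∫ t in (-π)..π, tailKernel α r β n (x - t) * ψ (t + h) := by
    rw [← integral_comp_add_right_of_periodic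
      (F := fun t => tailKernel α r β n (x + h - t) * ψ t) (h := h)
      fun t => by simp only [hper t, ← sub_sub, (tailKernel_periodic α r β n).sub_eq]]
    refine intervalIntegral.integral_congr fun t _ => ?_
    have e : x + h - (t + h) = x - t := by ring
    simp only [e]
  rw [intervalIntegral.integral_const_mul]
  have h2 : ∀ t, tailKernel α r β n (x - t) * (1 / 2 * (ψ t - ψ (t + h))) =
      1 / 2 * (tailKernel α r β n (x - t) * ψ t - tailKernel α r β n (x - t) * ψ (t + h)) :=
    fun t => by ring
  simp only [h2, sub_mul]
  rw [intervalIntegral.integral_const_mul, intervalIntegral.integral_sub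
    (Continuous.intervalIntegrable (by fun_prop) _ _)
    (Continuous.intervalIntegrable (by fun_prop) _ _), intervalIntegral.integral_sub
    (Continuous.intervalIntegrable (by fun_prop) _ _)
    (Continuous.intervalIntegrable (by fun_prop) _ _), h1]

lemma fourierDeviation_le_circleNorm (hα : 0 < α) (hn : 1 ≤ n) (hν : 1 < n * decayRate α r n)
    {p q : ℝ} (hpq : p.HolderConjugate q) :
    fourierDeviation α r β (ENNReal.ofReal p) n ≤
      ((1 / π * circleNorm q (tailKernel α r β n) : ℝ) : EReal) :=
  fourierDeviation_le hα hn hν (by simpa using hpq.lt.le) fun _ hφ x =>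
    abs_integral_conv_le hpq (continuous_tailKernel hα β hn hν) (tailKernel_periodic α r β n) hφ x

lemma abs_integral_mul_le_circleNorm {p q : ℝ} (hpq : p.HolderConjugate q) {u v : ℝ → ℝ}
    (hu : Continuous u) (hv : Continuous v) :
    |∫ t in (-π)..π, u t * v t| ≤ circleNorm p u * circleNorm q v := by
  have h := integral_mul_norm_le_Lp_mul_Lq hpq (memLp_restrict_Ioc hu _) (memLp_restrict_Ioc hv _)
  simp only [Real.norm_eq_abs, ← intervalIntegral.integral_of_le neg_pi_le_pi] at h
  refine (intervalIntegral.abs_integral_le_integral_abs neg_pi_le_pi).trans ?_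
  simpa only [abs_mul, circleNorm] using h

/-- The kernel difference is twice the kernel minus the sum of its two translates. The norming
function recovers the full norm from the first part, and Hölder bounds the second. -/
lemma circleNorm_le_fourierDeviation (hα : 0 < α) (hn : 1 ≤ n) (hν : 1 < n * decayRate α r n)
    {p q : ℝ} (hpq : p.HolderConjugate q) (h : ℝ) :
    ((1 / π * (circleNorm q (tailKernel α r β n) - 1 / 2 * circleNorm q
      fun t => tailKernel α r β n t + tailKernel α r β n (t + h)) : ℝ) : EReal) ≤
      fourierDeviation α r β (ENNReal.ofReal p) n := by
  have hQ := continuous_tailKernel hα β hn hν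
  set Q := tailKernel α r β n with hQdef
  have hQper : Function.Periodic Q (2 * π) := tailKernel_periodic α r β n
  have hu : Continuous fun t => Q (0 - t) := by fun_prop
  obtain ⟨ψ, hψc, hψper, hψ1, hψ2⟩ := exists_norming hpq hu
    fun t => by simp only [← sub_sub, hQper.sub_eq]
  refine le_trans (EReal.coe_le_coe_iff.2 ?_)
    (le_fourierDeviation_of_test (β := β) hα hn hν hpq.lt.le hψc hψper hψ1 0 h)
  have hpi := Real.pi_pos
  have e1 : circleNorm q (fun t => Q (0 - t)) = circleNorm q Q := by
    simp only [zero_sub, circleNorm_comp_neg]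
  have hw : Continuous fun t => Q t + Q (t + h) := by fun_prop
  have e2 : circleNorm q (fun t => Q (0 - t) + Q (0 + h - t)) =
      circleNorm q fun t => Q t + Q (t + h) := by
    rw [← circleNorm_comp_neg fun t => Q t + Q (t + h)]
    simp only [zero_add, sub_eq_add_neg, add_comm h]
  have hc2 : Continuous fun t => Q (0 - t) + Q (0 + h - t) := by fun_prop
  have h3 := (le_abs_self _).trans (abs_integral_mul_le_circleNorm hpq.symm hc2 hψc)
  have e3 : ∫ t in (-π)..π, (Q (0 - t) - Q (0 + h - t)) * ψ t =
      2 * (∫ t in (-π)..π, Q (0 - t) * ψ t) -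
        ∫ t in (-π)..π, (Q (0 - t) + Q (0 + h - t)) * ψ t := by
    rw [← intervalIntegral.integral_const_mul, ← intervalIntegral.integral_sub
      (Continuous.intervalIntegrable (by fun_prop) _ _)
      (Continuous.intervalIntegrable (by fun_prop) _ _)]
    refine intervalIntegral.integral_congr fun t _ => ?_
    ring
  rw [e2] at h3
  rw [← hQdef, e3, hψ2, e1]
  have h4 := mul_le_of_le_one_right (circleNorm_nonneg q fun t => Q t + Q (t + h)) hψ1
  gcongr
  linarith

/-- Evaluation at a point is not given by an integrable function, so it is reached as a limit of
admissible test functions concentrating there. -/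
lemma half_difference_le_fourierDeviation_one (hα : 0 < α) (hn : 1 ≤ n)
    (hν : 1 < n * decayRate α r n) (x h : ℝ) :
    ((1 / π * (1 / 2 * (tailKernel α r β n x - tailKernel α r β n (x + h))) : ℝ) : EReal) ≤
      fourierDeviation α r β 1 n := by
  have hQ := continuous_tailKernel hα β hn hν
  set Q := tailKernel α r β n with hQdef
  have hpi := Real.pi_pos
  -- On `[-π, π]` this function has its unique maximum at `0`, so its normalized powers form a
  -- periodic approximate identity.
  set c : ℝ → ℝ := fun t => 1 + Real.cos t with hc
  have hcc : Continuous c := by fun_prop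
  have hc0 : ∀ t, 0 ≤ c t := fun t => by simp only [hc]; linarith [Real.neg_one_le_cos t]
  set w : ℕ → ℝ := fun m => ∫ t in (-π)..π, c t ^ m with hw
  have hwpos : ∀ m, 0 < w m := fun m => by
    refine intervalIntegral.intervalIntegral_pos_of_pos_on
      ((hcc.pow m).intervalIntegrable _ _) (fun t ht => pow_pos ?_ m) (by linarith)
    have := Real.cos_lt_cos_of_nonneg_of_le_pi (abs_nonneg t) le_rfl (abs_lt.2 ht)
    rw [Real.cos_abs, Real.cos_pi] at this
    simp only [hc]; linarith
  have hlim : Tendsto (fun m : ℕ => 1 / π * (1 / 2 * ∫ t in (-π)..π,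
      (Q (x - t) - Q (x + h - t)) * (c t ^ m / w m))) atTop
      (𝓝 (1 / π * (1 / 2 * (Q x - Q (x + h))))) := by
    refine Tendsto.const_mul _ (Tendsto.const_mul _ ?_)
    have ht := tendsto_setIntegral_pow_smul_of_unique_maximum_of_isCompact_of_continuousOn
      (μ := volume) (s := Icc (-π) π) (x₀ := 0) (c := c)
      (g := fun t => Q (x - t) - Q (x + h - t)) isCompact_Icc hcc.continuousOn ?_
      (fun t _ => hc0 t) (by simp [hc]) ?_
      (Continuous.continuousOn (by fun_prop))
    · simp only [sub_zero] at ht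
      refine ht.congr fun m => ?_
      simp only [integral_Icc_eq_integral_Ioc, ← intervalIntegral.integral_of_le neg_pi_le_pi,
        smul_eq_mul]
      rw [← intervalIntegral.integral_const_mul]
      refine intervalIntegral.integral_congr fun t _ => ?_
      simp only [hw]
      ring
    · intro t ht ht0
      simp only [hc]
      have := Real.cos_lt_cos_of_nonneg_of_le_pi (x := 0) le_rfl (abs_le.2 ht) (abs_pos.2 ht0)
      rw [Real.cos_abs] at this
      linarith
    · rw [interior_Icc]
      exact subset_closure ⟨by linarith, hpi⟩
  refine le_of_tendsto ((continuous_coe_real_ereal.tendsto _).comp hlim)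
    (Eventually.of_forall fun m => ?_)
  have hψc : Continuous fun t => c t ^ m / w m := (hcc.pow m).div_const _
  have h1 := le_fourierDeviation_of_test (β := β) hα hn hν le_rfl hψc
    (fun t => by simp only [hc, Real.cos_add_two_pi]) ?_ x h
  · rw [ENNReal.ofReal_one] at h1
    exact h1
  · have e : ∀ t, |c t ^ m / w m| ^ (1 : ℝ) = c t ^ m / w m := fun t => by
      rw [Real.rpow_one, abs_of_nonneg (div_nonneg (pow_nonneg (hc0 t) m) (hwpos m).le)]
    simp only [circleNorm, e]
    rw [intervalIntegral.integral_div, div_self (hwpos m).ne', Real.one_rpow]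

end deviation

/-! ### The norm of `(δ² + t²) ^ (-1 / 2)` on the period and on the line -/

/-- `∫_0^∞ (t² + 1) ^ (-q / 2) dt`. -/
def bracketIntegral (q : ℝ) : ℝ := ∫ t in Ioi (0 : ℝ), 1 / (t ^ 2 + 1) ^ (q / 2)

section bracket

variable {p q δ : ℝ}

lemma integrable_bracket (hq : 1 < q) : Integrable fun t : ℝ => 1 / (t ^ 2 + 1) ^ (q / 2) := by
  have h := integrable_rpow_neg_one_add_norm_sq (E := ℝ) (μ := volume) (r := q) (by simpa using hq)
  refine h.congr (Filter.Eventually.of_forall fun t => ?_)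
  simp only [Real.norm_eq_abs, sq_abs, one_div]
  rw [← Real.rpow_neg (by positivity), neg_div, add_comm]

lemma bracket_le_rpow (hq : 1 < q) {t : ℝ} (ht : 0 < t) :
    1 / (t ^ 2 + 1) ^ (q / 2) ≤ t ^ (-q) := by
  rw [Real.rpow_neg ht.le, ← one_div]
  have e : t ^ q = (t ^ 2) ^ (q / 2) := by
    rw [← Real.rpow_natCast, ← Real.rpow_mul ht.le]; congr 1; push_cast; ring
  rw [e]
  gcongr
  linarith

lemma setIntegral_Ioi_bracket_le (hq : 1 < q) {c : ℝ} (hc : 0 < c) :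
    ∫ t in Ioi c, 1 / (t ^ 2 + 1) ^ (q / 2) ≤ c ^ (1 - q) / (q - 1) := by
  have h1 : ∫ t in Ioi c, t ^ (-q) = c ^ (1 - q) / (q - 1) := by
    rw [integral_Ioi_rpow_of_lt (by linarith) hc, ← neg_div_neg_eq, neg_neg]
    congr 1
    · congr 1; ring
    · ring
  rw [← h1]
  exact setIntegral_mono_on (integrable_bracket hq).integrableOn
    (integrableOn_Ioi_rpow_of_lt (by linarith) hc) measurableSet_Ioi
    fun t ht => bracket_le_rpow hq (hc.trans ht)

lemma bracketIntegral_eq_add (hq : 1 < q) {c : ℝ} (hc : 0 ≤ c) :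
    bracketIntegral q = (∫ t in (0)..c, 1 / (t ^ 2 + 1) ^ (q / 2)) +
      ∫ t in Ioi c, 1 / (t ^ 2 + 1) ^ (q / 2) := by
  rw [bracketIntegral, ← Ioc_union_Ioi_eq_Ioi hc,
    setIntegral_union (Ioc_disjoint_Ioi le_rfl) measurableSet_Ioi
      (integrable_bracket hq).integrableOn (integrable_bracket hq).integrableOn,
    intervalIntegral.integral_of_le hc]

lemma setIntegral_bracket_nonneg (q : ℝ) (s : Set ℝ) :
    0 ≤ ∫ t in s, 1 / (t ^ 2 + 1) ^ (q / 2) :=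
  integral_nonneg fun t => by positivity

/-- The interval `[0, 1]` contributes at most `1` and the rest at most `1 / (q - 1)`; their sum is
`p`. -/
lemma bracketIntegral_le (hpq : p.HolderConjugate q) : bracketIntegral q ≤ p := by
  have hq := hpq.symm.lt
  rw [bracketIntegral_eq_add hq zero_le_one]
  have h1 := setIntegral_Ioi_bracket_le hq one_pos
  have h2 : ∫ t in (0 : ℝ)..1, 1 / (t ^ 2 + 1) ^ (q / 2) ≤ ∫ t in (0 : ℝ)..1, (1 : ℝ) := by
    refine intervalIntegral.integral_mono_on zero_le_one
      (integrable_bracket hq).intervalIntegrable intervalIntegrable_const fun t _ => ?_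
    rw [div_le_one (by positivity)]
    exact Real.one_le_rpow (by nlinarith [sq_nonneg t]) (by linarith)
  rw [intervalIntegral.integral_const, smul_eq_mul] at h2
  rw [Real.one_rpow] at h1
  have h3 : 1 + 1 / (q - 1) = p := by
    have : q - 1 ≠ 0 := by linarith
    have h4 := hpq.mul_eq_add
    field_simp
    linarith
  linarith

lemma two_rpow_neg_le_bracketIntegral (hq : 1 < q) : (2 : ℝ) ^ (-q) ≤ bracketIntegral q := by
  rw [bracketIntegral_eq_add hq zero_le_one]
  have h2 : ∫ t in (0 : ℝ)..1, (2 : ℝ) ^ (-q) ≤ ∫ t in (0 : ℝ)..1, 1 / (t ^ 2 + 1) ^ (q / 2) := by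
    refine intervalIntegral.integral_mono_on zero_le_one intervalIntegrable_const
      (integrable_bracket hq).intervalIntegrable fun t ht => ?_
    rw [Real.rpow_neg (by norm_num), ← one_div]
    have h3 : (t ^ 2 + 1) ^ (q / 2) ≤ (2 : ℝ) ^ (q / 2) := by
      refine Real.rpow_le_rpow (by positivity) ?_ (by linarith)
      nlinarith [ht.1, ht.2]
    have h4 : (2 : ℝ) ^ (q / 2) ≤ 2 ^ q :=
      Real.rpow_le_rpow_of_exponent_le (by norm_num) (by linarith)
    gcongr
    exact h3.trans h4
  rw [intervalIntegral.integral_const, smul_eq_mul] at h2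
  linarith [setIntegral_bracket_nonneg q (Ioi 1)]

lemma bracketIntegral_pos (hq : 1 < q) : 0 < bracketIntegral q :=
  (Real.rpow_pos_of_pos two_pos _).trans_le (two_rpow_neg_le_bracketIntegral hq)

lemma continuous_inv_sqrt (hδ : 0 < δ) : Continuous fun t : ℝ => (√(δ ^ 2 + t ^ 2))⁻¹ :=
  Continuous.inv₀ (by fun_prop) fun t => by positivity

lemma circleNorm_inv_sqrt_rpow (hδ : 0 < δ) (hq : 1 < q) :
    circleNorm q (fun t => (√(δ ^ 2 + t ^ 2))⁻¹) ^ q =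
      2 * δ ^ (1 - q) * ∫ t in (0)..(π / δ), 1 / (t ^ 2 + 1) ^ (q / 2) := by
  rw [circleNorm_rpow (by linarith)]
  have e : ∀ t : ℝ, |(√(δ ^ 2 + t ^ 2))⁻¹| ^ q =
      δ ^ (-q) * (1 / ((t / δ) ^ 2 + 1) ^ (q / 2)) := fun t => by
    have h1 : δ ^ 2 + t ^ 2 = δ ^ 2 * ((t / δ) ^ 2 + 1) := by field_simp; ring
    rw [abs_of_pos (by positivity), h1, Real.sqrt_mul (by positivity), Real.sqrt_sq hδ.le,
      mul_inv, Real.mul_rpow (by positivity) (by positivity), Real.inv_rpow hδ.le,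
      ← Real.rpow_neg hδ.le, Real.inv_rpow (by positivity), Real.sqrt_eq_rpow,
      ← Real.rpow_mul (by positivity), one_div (_ ^ (q / 2))]
    congr 3; ring
  simp only [e]
  rw [intervalIntegral.integral_const_mul,
    intervalIntegral.integral_comp_div (fun t => 1 / (t ^ 2 + 1) ^ (q / 2)) hδ.ne']
  have hint : ∀ a b : ℝ, IntervalIntegrable (fun t : ℝ => 1 / (t ^ 2 + 1) ^ (q / 2)) volume a b :=
    fun a b => (integrable_bracket hq).intervalIntegrable
  have h2 : ∫ t in (-π / δ)..0, 1 / (t ^ 2 + 1) ^ (q / 2) =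
      ∫ t in (0)..(π / δ), 1 / (t ^ 2 + 1) ^ (q / 2) := by
    have := intervalIntegral.integral_comp_neg (a := 0) (b := π / δ)
      (fun t : ℝ => 1 / (t ^ 2 + 1) ^ (q / 2))
    simp only [neg_sq, neg_zero] at this
    rw [this, neg_div]
  rw [← intervalIntegral.integral_add_adjacent_intervals (hint _ 0) (hint 0 _), h2, smul_eq_mul]
  have h3 : δ ^ (1 - q) = δ * δ ^ (-q) := by
    rw [sub_eq_add_neg, Real.rpow_add hδ, Real.rpow_one]
  rw [h3]; ring

/-- The `L_q` norm of `(δ² + t²) ^ (-1 / 2)` over the real line. -/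
def lineNorm (p q δ : ℝ) : ℝ := (2 * bracketIntegral q) ^ (1 / q) * δ ^ (-(1 / p))

lemma lineNorm_nonneg (hδ : 0 < δ) (hq : 1 < q) : 0 ≤ lineNorm p q δ := by
  have := bracketIntegral_pos hq
  unfold lineNorm; positivity

lemma lineNorm_rpow (hδ : 0 < δ) (hpq : p.HolderConjugate q) :
    lineNorm p q δ ^ q = 2 * δ ^ (1 - q) * bracketIntegral q := by
  have h := bracketIntegral_pos hpq.symm.lt
  have hq := hpq.symm.pos
  rw [lineNorm, Real.mul_rpow (by positivity) (by positivity), ← Real.rpow_mul (by positivity),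
    ← Real.rpow_mul hδ.le, one_div_mul_cancel hq.ne', Real.rpow_one]
  have e : -(1 / p) * q = 1 - q := by
    have h1 : q / p = q - 1 := hpq.symm.div_conj_eq_sub_one
    rw [← neg_sub, ← h1]; ring
  rw [e]; ring

lemma circleNorm_inv_sqrt_le (hδ : 0 < δ) (hpq : p.HolderConjugate q) :
    circleNorm q (fun t => (√(δ ^ 2 + t ^ 2))⁻¹) ≤ lineNorm p q δ := by
  have hq := hpq.symm.lt
  rw [← Real.rpow_le_rpow_iff (circleNorm_nonneg _ _) (lineNorm_nonneg hδ hq) hpq.symm.pos,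
    lineNorm_rpow hδ hpq, circleNorm_inv_sqrt_rpow hδ hq,
    bracketIntegral_eq_add (c := π / δ) hq (by have := Real.pi_pos; positivity)]
  have := setIntegral_bracket_nonneg q (Ioi (π / δ))
  gcongr
  linarith

/-- The `q`-th powers differ by the integral beyond `π / δ`, which is explicit. Dividing by `κ ^ (q
- 1)`, where `κ` is the norm on the line, passes to the norms and produces the power of `δ`. -/
lemma lineNorm_sub_le (hδ : 0 < δ) (hpq : p.HolderConjugate q) :
    lineNorm p q δ - circleNorm q (fun t => (√(δ ^ 2 + t ^ 2))⁻¹) ≤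
      2 * (δ ^ ((q - 1) / p) / (q - 1)) := by
  have hq := hpq.symm.lt
  have hq0 := hpq.symm.pos
  have hp0 := hpq.pos
  have hq1 : 0 < q - 1 := by linarith
  have hI := bracketIntegral_pos hq
  have hpi := Real.pi_pos
  have hle := circleNorm_inv_sqrt_le hδ hpq
  have hA := lineNorm_rpow hδ hpq
  have hB := circleNorm_inv_sqrt_rpow hδ hq
  have htail := setIntegral_Ioi_bracket_le hq (div_pos hpi hδ)
  rw [bracketIntegral_eq_add hq (div_pos hpi hδ).le] at hA
  have hκ : 0 < lineNorm p q δ := by unfold lineNorm; positivity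
  have hκ1 : lineNorm p q δ ^ (q - 1) =
      (2 * bracketIntegral q) ^ (1 / p) * δ ^ (-((q - 1) / p)) := by
    rw [lineNorm, Real.mul_rpow (by positivity) (by positivity), ← Real.rpow_mul (by positivity),
      ← Real.rpow_mul hδ.le]
    congr 2
    · have := hpq.symm.one_sub_inv
      rw [one_div_mul_eq_div, sub_div, div_self hq0.ne', one_div, one_div, this]
    · ring
  set N := circleNorm q fun t => (√(δ ^ 2 + t ^ 2))⁻¹
  set κ := lineNorm p q δ
  have hN0 : 0 ≤ N := circleNorm_nonneg _ _
  have hNq : N ^ q ≤ N * κ ^ (q - 1) := by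
    rcases hN0.eq_or_lt with h | h
    · rw [← h, Real.zero_rpow hq0.ne', zero_mul]
    · have : N ^ q = N * N ^ (q - 1) := by
        rw [Real.rpow_sub_one h.ne']; field_simp
      rw [this]
      gcongr
  have hκq : κ ^ q = κ * κ ^ (q - 1) := by
    rw [Real.rpow_sub_one hκ.ne']; field_simp
  have hδq : δ ^ (1 - q) * (π / δ) ^ (1 - q) = π ^ (1 - q) := by
    rw [← Real.mul_rpow hδ.le (by positivity)]; congr 1; field_simp
  have hdiff : κ ^ q - N ^ q ≤ 2 * (π ^ (1 - q) / (q - 1)) := by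
    rw [hA, hB, ← hδq]
    have h0 : 0 < 2 * δ ^ (1 - q) := by positivity
    have := mul_le_mul_of_nonneg_left htail h0.le
    rw [mul_add, add_sub_cancel_left]
    exact this.trans (le_of_eq (by ring))
  -- The bound `2 ^ (-q)` for the integral gives `(2 I) ^ (1 / p) ≥ 2 ^ (1 - q)`, and `π > 2`. This
  -- keeps the final constant independent of `q`.
  have hlow : 1 ≤ (2 * bracketIntegral q) ^ (1 / p) * π ^ (q - 1) := by
    have h1 : (2 : ℝ) ^ (-q) ≤ 2 * bracketIntegral q := by
      linarith [two_rpow_neg_le_bracketIntegral hq]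
    have h2 : ((2 : ℝ) ^ (-q)) ^ (1 / p) * 2 ^ (q - 1) = 1 := by
      rw [← Real.rpow_mul (by norm_num), ← Real.rpow_add (by norm_num)]
      have h3 : q / p = q - 1 := hpq.symm.div_conj_eq_sub_one
      have : -q * (1 / p) + (q - 1) = 0 := by rw [← h3]; ring
      rw [this, Real.rpow_zero]
    have := Real.pi_gt_three
    refine h2.symm.le.trans ?_
    gcongr
    linarith
  -- Here `N ≤ κ` gives `N ^ q ≤ N κ ^ (q - 1)`, so the left side is at most `κ ^ q - N ^ q`.
  have hmain : κ ^ (q - 1) * (κ - N) ≤ 2 * (π ^ (1 - q) / (q - 1)) := by nlinarith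
  have hκ1pos : 0 < κ ^ (q - 1) := by positivity
  rw [← mul_le_mul_iff_right₀ hκ1pos]
  refine hmain.trans ?_
  rw [hκ1]
  have e1 : δ ^ (-((q - 1) / p)) * δ ^ ((q - 1) / p) = 1 := by
    rw [← Real.rpow_add hδ, neg_add_cancel, Real.rpow_zero]
  have e2 : π ^ (1 - q) * π ^ (q - 1) = 1 := by
    rw [← Real.rpow_add hpi]; simp
  have h5 : π ^ (1 - q) ≤ (2 * bracketIntegral q) ^ (1 / p) := by
    have : 0 < π ^ (1 - q) := by positivity
    nlinarith
  calc 2 * (π ^ (1 - q) / (q - 1)) ≤ 2 * ((2 * bracketIntegral q) ^ (1 / p) / (q - 1)) := by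
        gcongr
    _ = (2 * bracketIntegral q) ^ (1 / p) * (δ ^ (-((q - 1) / p)) * δ ^ ((q - 1) / p)) *
        (2 / (q - 1)) := by rw [e1]; ring
    _ = _ := by ring

lemma lineNorm_le (hδ : 0 < δ) (hpq : p.HolderConjugate q) :
    lineNorm p q δ ≤ 2 * (p ^ (1 / q) * δ ^ (-(1 / p))) := by
  have hI := bracketIntegral_pos hpq.symm.lt
  have hp := hpq.pos
  have hq := hpq.symm.lt
  have h1 : (2 * bracketIntegral q) ^ (1 / q) ≤ 2 * p ^ (1 / q) := by
    have h2 : (2 * bracketIntegral q) ^ (1 / q) ≤ (2 * p) ^ (1 / q) := by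
      have := bracketIntegral_le hpq
      gcongr
    rw [Real.mul_rpow (by norm_num) hp.le] at h2
    have h3 : (2 : ℝ) ^ (1 / q) ≤ 2 ^ (1 : ℝ) :=
      Real.rpow_le_rpow_of_exponent_le (by norm_num) (by rw [div_le_one] <;> linarith)
    rw [Real.rpow_one] at h3
    refine h2.trans ?_
    gcongr
  rw [lineNorm, ← mul_assoc]
  gcongr

/-- The product is at most `2 (p δ) ^ (1 / q)`. This is where the factor `p` in the threshold
condition is used. -/
lemma mul_lineNorm_le (hδ : 0 < δ) (hpq : p.HolderConjugate q) (hpδ : p * δ ≤ 1) :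
    δ * lineNorm p q δ ≤ 2 := by
  have hp := hpq.pos
  have hq := hpq.symm.pos
  have h1 : δ * δ ^ (-(1 / p)) = δ ^ (1 / q) := by
    have h2 : 1 / q = 1 + -(1 / p) := by
      have := hpq.one_sub_inv
      rw [one_div, one_div, ← this]; ring
    rw [h2, Real.rpow_add hδ, Real.rpow_one]
  calc δ * lineNorm p q δ ≤ δ * (2 * (p ^ (1 / q) * δ ^ (-(1 / p)))) := by
        have := lineNorm_le hδ hpq
        gcongr
    _ = 2 * (p * δ) ^ (1 / q) := by rw [Real.mul_rpow hp.le hδ.le, ← h1]; ring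
    _ ≤ 2 * 1 := by
        gcongr
        exact Real.rpow_le_one (by positivity) hpδ (by positivity)
    _ = 2 := by norm_num

end bracket

/-! ### Consequences of the threshold -/

section threshold

variable {α r p : ℝ}

lemma threshold_term_eq {n : ℕ} (hn : 1 ≤ n) :
    1 / (α * r) * (1 / (n : ℝ) ^ r) + α * r * p / (n : ℝ) ^ (1 - r) =
      1 / (n * decayRate α r n) + p * decayRate α r n := by
  have h : (0 : ℝ) < n := by exact_mod_cast hn
  rw [nat_mul_decayRate α r hn, decayRate, ← neg_sub 1 r, Real.rpow_neg h.le, one_div_mul_one_div]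
  ring

/-- The condition is monotone in `n`. The two cases of its right side are both at most `1 / 14`, and
only this weaker bound is retained. -/
lemma le_of_threshold_le (hα : 0 < α) (hr0 : 0 < r) (hr1 : r < 1) (hp : 1 ≤ p) {n : ℕ}
    (hn : threshold α r p ≤ n) :
    1 ≤ n ∧ 1 / (n * decayRate α r n) + p * decayRate α r n ≤ 1 / 14 := by
  set c : ℝ := if p = 1 then 1 / 14 else 1 / (3 * π) ^ 3 * ((p - 1) / p) with hc
  have hpi := Real.pi_gt_three
  have hp0 : 0 < p := by linarith
  have hc0 : 0 < c := by
    rw [hc]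
    split_ifs with h
    · norm_num
    · have : 0 < p - 1 := by
        rcases hp.eq_or_lt with h' | h'
        · exact absurd h'.symm h
        · linarith
      positivity
  have hc1 : c ≤ 1 / 14 := by
    rw [hc]
    split_ifs with h
    · exact le_rfl
    · have h1 : (p - 1) / p ≤ 1 := by rw [div_le_one hp0]; linarith
      have h2 : 1 / (3 * π) ^ 3 ≤ 1 / 14 := by
        apply one_div_le_one_div_of_le (by norm_num)
        calc (14 : ℝ) ≤ (3 * 3) ^ 3 := by norm_num
          _ ≤ (3 * π) ^ 3 := by gcongr
      have h3 : 0 < 1 / (3 * π) ^ 3 := by positivity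
      nlinarith
  set F : ℕ → ℝ := fun n => 1 / (α * r) * (1 / (n : ℝ) ^ r) + α * r * p / (n : ℝ) ^ (1 - r)
    with hF
  have hlim : Tendsto F atTop (𝓝 0) := by
    have h1 : ∀ s : ℝ, 0 < s → Tendsto (fun n : ℕ => ((n : ℝ) ^ s)⁻¹) atTop (𝓝 0) := fun s hs =>
      ((tendsto_rpow_atTop hs).comp tendsto_natCast_atTop_atTop).inv_tendsto_atTop
    have h2 := ((h1 r hr0).const_mul (1 / (α * r))).add
      ((h1 (1 - r) (by linarith)).const_mul (α * r * p))
    simpa only [mul_zero, add_zero, hF, one_div, div_eq_mul_inv, one_mul] using h2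
  -- Without nonemptiness the infimum would default to `0` and carry no information.
  have hne : {n : ℕ | 1 ≤ n ∧ F n ≤ c}.Nonempty := by
    obtain ⟨N, hN1, hN2⟩ :=
      ((eventually_ge_atTop 1).and (hlim.eventually (eventually_le_nhds hc0))).exists
    exact ⟨N, hN1, hN2⟩
  obtain ⟨h1, h2⟩ : 1 ≤ threshold α r p ∧ F (threshold α r p) ≤ c := Nat.sInf_mem hne
  have hn1 : 1 ≤ n := h1.trans hn
  refine ⟨hn1, ?_⟩
  rw [← threshold_term_eq hn1]
  refine le_trans ?_ (h2.trans hc1)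
  have h3 : (0 : ℝ) < threshold α r p := by exact_mod_cast h1
  have h4 : (threshold α r p : ℝ) ≤ n := by exact_mod_cast hn
  have h5 : 0 < 1 - r := by linarith
  simp only [hF]
  gcongr

end threshold

/-! ### The deviation for exponents above one -/

section estimates

variable {α r β p q : ℝ} {n : ℕ}

lemma bounds_of_threshold_term_le (hp : 1 ≤ p) (hδ : 0 < decayRate α r n) (hn : 1 ≤ n)
    (h : 1 / (n * decayRate α r n) + p * decayRate α r n ≤ 1 / 14) :
    14 ≤ n * decayRate α r n ∧ p * decayRate α r n ≤ 1 ∧ decayRate α r n ≤ 1 / 14 := by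
  have hn0 : (0 : ℝ) < n := by exact_mod_cast hn
  have hν : 0 < n * decayRate α r n := by positivity
  have h1 : 0 < 1 / (n * decayRate α r n) := by positivity
  have h2 : 0 < p * decayRate α r n := by positivity
  have h3 : 1 / (n * decayRate α r n) ≤ 1 / 14 := by linarith
  refine ⟨(one_div_le_one_div hν (by norm_num)).1 h3, by linarith, ?_⟩
  nlinarith

lemma modelError_le (hν : 14 ≤ n * decayRate α r n) :
    modelError α r n ≤ decayRate α r n + 5 / 4 / (n * decayRate α r n) := by
  have h : 1 / (n * decayRate α r n - 1) ≤ 5 / 4 / (n * decayRate α r n) := by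
    rw [div_le_div_iff₀ (by linarith) (by linarith)]
    linarith
  rw [modelError]
  linarith

/-- Two-sided bounds determine an extended real up to the length of the interval. -/
lemma exists_coe_eq_of_le_of_le {E : EReal} {L U : ℝ} (hL : (L : EReal) ≤ E)
    (hU : E ≤ (U : EReal)) : ∃ D : ℝ, E = (D : EReal) ∧ L ≤ D ∧ D ≤ U := by
  have h1 : E ≠ ⊤ := (hU.trans_lt (EReal.coe_lt_top U)).ne
  have h2 : E ≠ ⊥ := ((EReal.bot_lt_coe L).trans_le hL).ne'
  refine ⟨E.toReal, (EReal.coe_toReal h1 h2).symm, ?_, ?_⟩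
  · rwa [← EReal.coe_le_coe_iff, EReal.coe_toReal h1 h2]
  · rwa [← EReal.coe_le_coe_iff, EReal.coe_toReal h1 h2]

lemma circleNorm_cos_div_le (hq : 1 ≤ q) : circleNorm q Real.cos / (2 * π) ^ (1 / q) ≤ 1 := by
  have hpi := Real.pi_pos
  rw [div_le_one (by positivity)]
  have h := circleNorm_le_of_abs_le hq Real.continuous_cos (C := 1)
    fun t _ => Real.abs_cos_le_one t
  rwa [one_mul] at h

lemma two_pi_rpow_le (hq : 1 ≤ q) : (2 * π) ^ (1 / q) ≤ 7 := by
  have hpi := Real.pi_gt_three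
  have hpi2 := Real.pi_lt_d2
  have h : (2 * π) ^ (1 / q) ≤ (2 * π) ^ (1 : ℝ) :=
    Real.rpow_le_rpow_of_exponent_le (by linarith) (by rw [div_le_one] <;> linarith)
  rw [Real.rpow_one] at h
  linarith

lemma circleNorm_geomModel_shift_le {δ : ℝ} (hδ : 0 < δ) (hδ1 : δ ≤ 1 / 14) (hq : 0 < q) (h : ℝ) :
    circleNorm q (fun t => ‖geomModel δ (t + h) - geomModel δ t‖) ≤
      |h| * (2 / δ) * circleNorm q (fun t => ‖geomModel δ t‖) := by
  have hc := continuous_geomModel hδ hδ1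
  have e : |h| * (2 / δ) = |(|h| * (2 / δ))| := (abs_of_nonneg (by positivity)).symm
  rw [e, ← circleNorm_const_mul hq]
  refine circleNorm_mono hq (by fun_prop) (by fun_prop) fun t _ => ?_
  rw [abs_norm, abs_of_nonneg (by positivity)]
  exact norm_geomModel_add_sub_le hδ hδ1 t h

lemma circleNorm_geomModel_le {δ : ℝ} (hδ : 0 < δ) (hδ1 : δ ≤ 1 / 14)
    (hpq : p.HolderConjugate q) :
    circleNorm q (fun t => ‖geomModel δ t‖) ≤ 2 * lineNorm p q δ := by
  have hc := continuous_geomModel hδ hδ1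
  have hK := continuous_inv_sqrt hδ
  have h : circleNorm q (fun t => ‖geomModel δ t‖) ≤
      circleNorm q fun t => 2 * (√(δ ^ 2 + t ^ 2))⁻¹ := by
    refine circleNorm_mono hpq.symm.pos (by fun_prop) (by fun_prop) fun t ht => ?_
    rw [abs_norm, abs_of_nonneg (by positivity)]
    exact norm_geomModel_le_inv_sqrt hδ hδ1 ht
  rw [circleNorm_const_mul hpq.symm.pos, abs_two] at h
  linarith [circleNorm_inv_sqrt_le hδ hpq]

/-- A pointwise error `3` over the period, with `(2 π) ^ (1 / q) ≤ 7`. -/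
lemma abs_circleNorm_geomModel_sub_le {δ : ℝ} (hδ : 0 < δ) (hδ1 : δ ≤ 1 / 14) (hq : 1 ≤ q) :
    |circleNorm q (fun t => ‖geomModel δ t‖) - circleNorm q fun t => (√(δ ^ 2 + t ^ 2))⁻¹| ≤
      21 := by
  have hc := continuous_geomModel hδ hδ1
  have hK := continuous_inv_sqrt hδ
  refine (abs_circleNorm_sub_le hq (by fun_prop) hK).trans
    ((circleNorm_le_of_abs_le (C := 3) hq (by fun_prop) fun t ht => ?_).trans ?_)
  · have hz : (√(δ ^ 2 + t ^ 2))⁻¹ = ‖(δ - t * I : ℂ)⁻¹‖ := by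
      rw [norm_inv, ← Real.sqrt_sq (norm_nonneg _), Complex.sq_norm, Complex.normSq_apply]
      congr 2; simp; ring
    rw [hz]
    exact (abs_norm_sub_norm_le _ _).trans (norm_geomModel_sub_inv_le hδ hδ1 ht)
  · linarith [two_pi_rpow_le hq]

/-- In `4 η κ` the part `δ κ ≤ 2` of `η κ` gives the `8`, and the part `(5 / 4) κ / ν` gives the
`5`. -/
lemma circleNorm_tailSeries_sub_le (hα : 0 < α) (hr0 : 0 < r) (hr1 : r < 1) (hn : 1 ≤ n)
    (hpq : p.HolderConjugate q) (hν : 14 ≤ n * decayRate α r n)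
    (hpδ : p * decayRate α r n ≤ 1) (hδ1 : decayRate α r n ≤ 1 / 14) :
    circleNorm q (fun t => ‖tailSeries α r n t - geomModel (decayRate α r n) t‖) ≤
      8 + 5 * (lineNorm p q (decayRate α r n) / (n * decayRate α r n)) := by
  have hδ := decayRate_pos hα hr0 hn
  have hν1 : 1 < n * decayRate α r n := by linarith
  have hG := continuous_tailSeries hα hn hν1
  have hc := continuous_geomModel hδ hδ1
  have hK := continuous_inv_sqrt hδ
  have hη : 0 < modelError α r n := by
    have : 0 < n * decayRate α r n - 1 := by linarith
    unfold modelError; positivity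
  have h : circleNorm q (fun t => ‖tailSeries α r n t - geomModel (decayRate α r n) t‖) ≤
      circleNorm q fun t => 4 * modelError α r n * (√(decayRate α r n ^ 2 + t ^ 2))⁻¹ := by
    refine circleNorm_mono hpq.symm.pos (by fun_prop) (by fun_prop) fun t ht => ?_
    rw [abs_norm, abs_of_nonneg (by positivity)]
    exact norm_tailSeries_sub_mul_sqrt_le hα hr0 hr1 hn hν1 ht
  rw [circleNorm_const_mul hpq.symm.pos, abs_of_pos (by positivity)] at h
  have h1 := circleNorm_inv_sqrt_le hδ hpq
  have h2 := mul_lineNorm_le hδ hpq hpδ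
  have h3 := modelError_le hν
  have h4 := lineNorm_nonneg (p := p) hδ hpq.symm.lt
  calc _ ≤ _ := h
    _ ≤ 4 * (decayRate α r n + 5 / 4 / (n * decayRate α r n)) *
        lineNorm p q (decayRate α r n) := by
        have := circleNorm_nonneg q fun t => (√(decayRate α r n ^ 2 + t ^ 2))⁻¹
        gcongr
    _ = 4 * (decayRate α r n * lineNorm p q (decayRate α r n)) +
        5 * (lineNorm p q (decayRate α r n) / (n * decayRate α r n)) := by ring
    _ ≤ _ := by linarith

/-- The deviation in terms of the norm of `(δ² + t²) ^ (-1 / 2)` for `1 < p < ∞`. -/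
lemma exists_fourierDeviation_eq (hα : 0 < α) (hr0 : 0 < r) (hr1 : r < 1) (hn : 1 ≤ n)
    (hpq : p.HolderConjugate q)
    (h14 : 1 / (n * decayRate α r n) + p * decayRate α r n ≤ 1 / 14) :
    ∃ D : ℝ, fourierDeviation α r β (ENNReal.ofReal p) n = (D : EReal) ∧
      |D - Real.exp (-α * (n : ℝ) ^ r) * (1 / π *
        (circleNorm q Real.cos / (2 * π) ^ (1 / q) * lineNorm p q (decayRate α r n)))| ≤
      Real.exp (-α * (n : ℝ) ^ r) * (60 * (decayRate α r n ^ ((q - 1) / p) / (q - 1) +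
        p ^ (1 / q) * decayRate α r n ^ (-(1 / p)) / (n * decayRate α r n) + 1)) := by
  have hδ := decayRate_pos hα hr0 hn
  obtain ⟨hν, hpδ, hδ1⟩ := bounds_of_threshold_term_le hpq.lt.le hδ hn h14
  have hν1 : 1 < n * decayRate α r n := by linarith
  have hq1 : 1 < q := hpq.symm.lt
  have hq0 : 0 < q := hpq.symm.pos
  have hpi := Real.pi_gt_three
  have hpi2 := Real.pi_lt_d2
  have hnpos : (0 : ℝ) < n := by exact_mod_cast hn
  have hGc := continuous_tailSeries hα hn hν1
  have hG0c := continuous_geomModel hδ hδ1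
  have hA := circleNorm_tailSeries_sub_le hα hr0 hr1 hn hpq hν hpδ hδ1
  have hκ := lineNorm_le hδ hpq
  have hκ0 := lineNorm_nonneg (p := p) hδ hq1
  have hGm := circleNorm_geomModel_le hδ hδ1 hpq
  have hGK := abs_circleNorm_geomModel_sub_le hδ hδ1 hq1.le
  have hKκ := circleNorm_inv_sqrt_le hδ hpq
  have hKκ2 := lineNorm_sub_le hδ hpq
  have hcq := circleNorm_cos_div_le hq1.le
  have hcq0 : 0 ≤ circleNorm q Real.cos / (2 * π) ^ (1 / q) :=
    div_nonneg (circleNorm_nonneg _ _) (by positivity)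
  have hshift : ∀ s, |s| ≤ π → circleNorm q (fun t => ‖geomModel (decayRate α r n) (t + s / n) -
      geomModel (decayRate α r n) t‖) ≤
      13 * (lineNorm p q (decayRate α r n) / (n * decayRate α r n)) := fun s hs => by
    refine (circleNorm_geomModel_shift_le hδ hδ1 hq0 _).trans ?_
    rw [abs_div, abs_of_pos hnpos]
    calc |s| / n * (2 / decayRate α r n) *
          circleNorm q (fun t => ‖geomModel (decayRate α r n) t‖)
        ≤ 3.15 / n * (2 / decayRate α r n) * (2 * lineNorm p q (decayRate α r n)) := by
          have := circleNorm_nonneg q fun t => ‖geomModel (decayRate α r n) t‖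
          have := hs.trans hpi2.le
          gcongr
      _ = 12.6 * (lineNorm p q (decayRate α r n) / (n * decayRate α r n)) := by
          field_simp; ring
      _ ≤ _ := by
          have : 0 ≤ lineNorm p q (decayRate α r n) / (n * decayRate α r n) := by positivity
          linarith
  set δ := decayRate α r n with hδd
  set G := tailSeries α r n with hGd
  set b := β * π / 2 with hb
  set E := Real.exp (-α * (n : ℝ) ^ r) with hE
  have hE0 : 0 < E := Real.exp_pos _
  set κ := lineNorm p q δ
  set A := circleNorm q fun t => ‖G t - geomModel δ t‖
  set cq := circleNorm q Real.cos / (2 * π) ^ (1 / q)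
  set N0 := circleNorm q fun t => ‖geomModel δ t‖
  set NK := circleNorm q fun t => (√(δ ^ 2 + t ^ 2))⁻¹
  set ρ := κ / (n * δ) with hρ
  have hρ0 : 0 ≤ ρ := by positivity
  have hphase := abs_circleNorm_modulate_sub_le hq1.le hn b hG0c (geomModel_periodic δ) hshift
  have hPP : |circleNorm q (modulate n b G) - circleNorm q (modulate n b (geomModel δ))| ≤ A := by
    refine (abs_circleNorm_sub_le hq1.le (continuous_modulate hGc n b)
      (continuous_modulate hG0c n b)).trans (circleNorm_mono hq0
      ((continuous_modulate hGc n b).sub (continuous_modulate hG0c n b)) (by fun_prop)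
      fun t _ => ?_)
    rw [modulate_sub, abs_norm]
    exact abs_modulate_le _ _ _ _
  have hQ : circleNorm q (tailKernel α r β n) = E * circleNorm q (modulate n b G) := by
    rw [← abs_of_pos hE0, ← circleNorm_const_mul hq0]
    rfl
  -- The shift by half a period of the carrier reverses its sign, so the sum only sees the
  -- oscillation of `G`, which is compared with that of the model.
  have hsum : circleNorm q (fun t => tailKernel α r β n t + tailKernel α r β n (t + π / n)) ≤
      E * (2 * A + 13 * ρ) := by
    have e : ∀ t, tailKernel α r β n t + tailKernel α r β n (t + π / n) =
        E * modulate n b (fun t => G t - G (t + π / n)) t := fun t => by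
      rw [tailKernel_eq_modulate, tailKernel_eq_modulate, modulate_add_div hn, modulate_sub_pi,
        ← modulate_sub]
      ring
    simp only [e]
    rw [circleNorm_const_mul hq0, abs_of_pos hE0]
    have h1 : circleNorm q (modulate n b fun t => G t - G (t + π / n)) ≤
        circleNorm q fun t => ‖G t - geomModel δ t‖ +
          (‖geomModel δ (t + π / n) - geomModel δ t‖ +
            ‖G (t + π / n) - geomModel δ (t + π / n)‖) := by
      refine circleNorm_mono hq0 (continuous_modulate (by fun_prop) n b) (by fun_prop)
        fun t _ => ?_
      rw [abs_of_nonneg (a := ‖G t - geomModel δ t‖ + _) (by positivity)]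
      refine (abs_modulate_le _ _ _ _).trans ?_
      have e2 : G t - G (t + π / n) = (G t - geomModel δ t) -
          ((geomModel δ (t + π / n) - geomModel δ t) +
            (G (t + π / n) - geomModel δ (t + π / n))) := by ring
      rw [e2]
      exact (norm_sub_le _ _).trans (by gcongr; exact norm_add_le _ _)
    have h2 := circleNorm_add_le hq1.le (f := fun t => ‖G t - geomModel δ t‖)
      (g := fun t => ‖geomModel δ (t + π / n) - geomModel δ t‖ +
            ‖G (t + π / n) - geomModel δ (t + π / n)‖) (by fun_prop) (by fun_prop)
    have h3 := circleNorm_add_le hq1.le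
      (f := fun t => ‖geomModel δ (t + π / n) - geomModel δ t‖)
      (g := fun t => ‖G (t + π / n) - geomModel δ (t + π / n)‖) (by fun_prop) (by fun_prop)
    have h4 : circleNorm q (fun t => ‖G (t + π / n) - geomModel δ (t + π / n)‖) = A :=
      circleNorm_comp_add (f := fun t => ‖G t - geomModel δ t‖)
        (fun t => by simp only [hGd, tailSeries_periodic α r n t, geomModel_periodic δ t]) _
    have h5 := hshift π (abs_of_pos (by linarith)).le
    gcongr
    linarith
  have hup := fourierDeviation_le_circleNorm (β := β) hα hn hν1 hpq
  have hlow := circleNorm_le_fourierDeviation (β := β) hα hn hν1 hpq (π / n)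
  obtain ⟨D, hD, hDL, hDU⟩ := exists_coe_eq_of_le_of_le hlow hup
  refine ⟨D, hD, ?_⟩
  rw [hQ] at hDL hDU
  set P := circleNorm q (modulate n b G)
  -- A chain of four replacements: `G` by the model, one phase by the average, the model by `1 /
  -- √(δ² + t²)`, and the period by the line.
  have hmain : |P - cq * κ| ≤ A + 13 * ρ + 21 + 2 * (δ ^ ((q - 1) / p) / (q - 1)) := by
    have h1 : |cq * N0 - cq * NK| ≤ 21 := by
      rw [← mul_sub, abs_mul, abs_of_nonneg hcq0]
      have := abs_nonneg (N0 - NK)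
      nlinarith
    have h2 : |cq * NK - cq * κ| ≤ 2 * (δ ^ ((q - 1) / p) / (q - 1)) := by
      rw [← mul_sub, abs_mul, abs_of_nonneg hcq0, abs_sub_comm,
        abs_of_nonneg (sub_nonneg.2 hKκ)]
      nlinarith
    rw [abs_le] at *
    constructor <;> linarith [h1.1, h1.2, h2.1, h2.2, hPP.1, hPP.2, hphase.1, hphase.2]
  have hX2 : ρ ≤ 2 * (p ^ (1 / q) * δ ^ (-(1 / p)) / (n * δ)) := by
    rw [hρ, ← mul_div_assoc]
    gcongr
  have hq1' : 0 < q - 1 := by linarith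
  have hX1 : 0 ≤ δ ^ ((q - 1) / p) / (q - 1) := by positivity
  set X1 := δ ^ ((q - 1) / p) / (q - 1)
  set X2 := p ^ (1 / q) * δ ^ (-(1 / p)) / (n * δ)
  have hinv0 : 0 < 1 / π := by positivity
  have hinv1 : 1 / π ≤ 1 := by rw [div_le_one] <;> linarith
  -- The lower side is the costly one: `2 A + 19.5 ρ + 21 + 2 X1`, where `A ≤ 8 + 5 ρ` and `ρ ≤ 2
  -- X2`, is at most `37 + 59 X2 + 2 X1`.
  have hbd : |D - E * (1 / π * (cq * κ))| ≤ 1 / π * E * (60 * (X1 + X2 + 1)) := by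
    have hU : D - E * (1 / π * (cq * κ)) ≤ 1 / π * E * (P - cq * κ) := by
      refine (sub_le_sub_right hDU _).trans (le_of_eq ?_); ring
    have hL : 1 / π * E * (P - cq * κ - (A + 6.5 * ρ)) ≤ D - E * (1 / π * (cq * κ)) := by
      have h1 : 1 / π * (E * P - 1 / 2 * (E * (2 * A + 13 * ρ))) ≤ D := by
        refine le_trans ?_ hDL
        gcongr
      refine le_trans (le_of_eq ?_) (sub_le_sub_right h1 _)
      ring
    have hpos : 0 < 1 / π * E := by positivity
    rw [abs_le] at hmain ⊢
    constructor
    · refine le_trans ?_ hL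
      rw [← mul_neg]
      gcongr
      linarith [hmain.1]
    · refine hU.trans ?_
      gcongr
      linarith [hmain.2]
  refine hbd.trans ?_
  have hX : 0 ≤ X2 := by linarith
  rw [mul_assoc]
  exact mul_le_of_le_one_left (by positivity) hinv1

end estimates

/-! ### The deviation for exponent one -/

section integrable

variable {α r β : ℝ} {n : ℕ}

lemma norm_tailSeries_sub_le (hα : 0 < α) (hr0 : 0 < r) (hr1 : r < 1) (hn : 1 ≤ n)
    (hν : 14 ≤ n * decayRate α r n) (t : ℝ) :
    ‖tailSeries α r n t - geomModel (decayRate α r n) t‖ ≤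
      1 + 5 / 4 * (1 / (decayRate α r n * (n * decayRate α r n))) := by
  have hδ := decayRate_pos hα hr0 hn
  have h := (decayRate_mul_norm_tailSeries_sub_le hα hr0 hr1 hn (by linarith) t).trans
    (modelError_le hν)
  rw [← le_div_iff₀' hδ] at h
  refine h.trans (le_of_eq ?_)
  have : (0 : ℝ) < n := by exact_mod_cast hn
  field_simp

lemma norm_tailSeries_le (hα : 0 < α) (hr0 : 0 < r) (hn : 1 ≤ n)
    (hν : 14 ≤ n * decayRate α r n) (t : ℝ) :
    ‖tailSeries α r n t‖ ≤ 1 / decayRate α r n + 1 +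
      5 / 4 * (1 / (decayRate α r n * (n * decayRate α r n))) := by
  have hδ := decayRate_pos hα hr0 hn
  have hν1 : 1 < n * decayRate α r n := by linarith
  have h1 := norm_tsum_mul_exp_pow_le (summable_decayCoeff hα hn hν1).abs t
  simp only [abs_of_pos (decayCoeff_pos α r n _)] at h1
  have h2 := (decayRate_mul_tsum_le hα hr0 hn hν1).trans
    (add_le_add_right (modelError_le hν) 1)
  rw [← le_div_iff₀' hδ] at h2
  refine h1.trans (h2.trans (le_of_eq ?_))
  have : (0 : ℝ) < n := by exact_mod_cast hn
  field_simp
  ring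

lemma le_re_geomModel_zero {δ : ℝ} (hδ : 0 < δ) : 1 / δ ≤ (geomModel δ 0).re := by
  have h1 : Real.exp (-δ) < 1 := by rw [Real.exp_lt_one_iff]; linarith
  have e : geomModel δ 0 = ((1 - Real.exp (-δ))⁻¹ : ℝ) := by simp [geomModel]
  rw [e, Complex.ofReal_re, ← one_div]
  apply one_div_le_one_div_of_le (by linarith)
  linarith [Real.add_one_le_exp (-δ)]

/-- Near `0` the model stays close to its value there, which is at least `1 / δ`. The range `2 π /
n` accommodates both a point within `π / n` of `0` and its translate by `π / n`. -/
lemma re_tailSeries_ge (hα : 0 < α) (hr0 : 0 < r) (hr1 : r < 1) (hn : 1 ≤ n)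
    (hν : 14 ≤ n * decayRate α r n) (hδ1 : decayRate α r n ≤ 1 / 14) {t : ℝ}
    (ht : |t| ≤ 2 * π / n) :
    1 / decayRate α r n - 1 - 28 * (1 / (decayRate α r n * (n * decayRate α r n))) ≤
      (tailSeries α r n t).re := by
  have hδ := decayRate_pos hα hr0 hn
  have hnpos : (0 : ℝ) < n := by exact_mod_cast hn
  have h1 := norm_tailSeries_sub_le hα hr0 hr1 hn hν t
  have h2 := norm_geomModel_add_sub_le hδ hδ1 0 t
  have h3 := norm_geomModel_le hδ hδ1 0
  have h4 := le_re_geomModel_zero hδ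
  rw [zero_add] at h2
  have h5 : |t| * (2 / decayRate α r n) * ‖geomModel (decayRate α r n) 0‖ ≤
      26 * (1 / (decayRate α r n * (n * decayRate α r n))) := by
    have hpi := Real.pi_pos
    calc _ ≤ 2 * 3.15 / n * (2 / decayRate α r n) * (2 / decayRate α r n) := by
          have : |t| ≤ 2 * 3.15 / n := ht.trans (by gcongr; exact Real.pi_lt_d2.le)
          gcongr
      _ = 25.2 * (1 / (decayRate α r n * (n * decayRate α r n))) := by field_simp; ring
      _ ≤ _ := by gcongr; norm_num
  have h6 := (abs_le.1 ((Complex.abs_re_le_norm _).trans h1)).1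
  have h7 := (abs_le.1 ((Complex.abs_re_le_norm _).trans (h2.trans h5))).1
  simp only [Complex.sub_re] at h6 h7
  have h8 : 0 < 1 / (decayRate α r n * (n * decayRate α r n)) := by positivity
  linarith

/-- The deviation on the class of kernels of integrable functions. -/
lemma exists_fourierDeviation_one_eq (hα : 0 < α) (hr0 : 0 < r) (hr1 : r < 1) (hn : 1 ≤ n)
    (h14 : 1 / (n * decayRate α r n) + 1 * decayRate α r n ≤ 1 / 14) :
    ∃ D : ℝ, fourierDeviation α r β 1 n = (D : EReal) ∧
      |D - Real.exp (-α * (n : ℝ) ^ r) * (1 / π * (1 / decayRate α r n))| ≤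
      Real.exp (-α * (n : ℝ) ^ r) *
        (60 * (1 / (decayRate α r n * (n * decayRate α r n)) + 1)) := by
  have hδ := decayRate_pos hα hr0 hn
  obtain ⟨hν, -, hδ1⟩ := bounds_of_threshold_term_le le_rfl hδ hn h14
  have hν1 : 1 < n * decayRate α r n := by linarith
  have hpi := Real.pi_gt_three
  have hnpos : (0 : ℝ) < n := by exact_mod_cast hn
  have hE0 : 0 < Real.exp (-α * (n : ℝ) ^ r) := Real.exp_pos _
  have hGn := norm_tailSeries_le hα hr0 hn hν
  have hre := fun t => re_tailSeries_ge (t := t) hα hr0 hr1 hn hν hδ1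
  have hX : 0 < 1 / (decayRate α r n * (n * decayRate α r n)) := by positivity
  set X := 1 / (decayRate α r n * (n * decayRate α r n))
  set E := Real.exp (-α * (n : ℝ) ^ r)
  set δ := decayRate α r n
  have hQ : ∀ t, |tailKernel α r β n t| ≤ E * (1 / δ + 1 + 5 / 4 * X) := fun t => by
    rw [tailKernel_eq_modulate, abs_mul, abs_of_pos hE0]
    gcongr
    exact (abs_modulate_le _ _ _ _).trans (hGn t)
  have hup := fourierDeviation_le (β := β) hα hn hν1 le_rfl fun φ hφ x =>
    abs_integral_conv_le_of_abs_le (tailKernel_periodic α r β n) hQ hφ x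
  set b := β * π / 2 with hb
  -- The point nearest to `0` at which the carrier `exp (i (n x - b))` equals `1`; rounding yields
  -- `|x| ≤ π / n`. At `x + π / n` the carrier equals `-1`, so both kernel values contribute with
  -- the same sign.
  set x := (b - round (b / (2 * π)) * (2 * π)) / n with hx
  have hxn : n * x - b = ((-round (b / (2 * π)) : ℤ) : ℝ) * (2 * π) := by
    rw [hx]; push_cast; field_simp; ring
  have hxabs : |x| ≤ π / n := by
    rw [hx, abs_div, abs_of_pos hnpos]
    gcongr
    have h1 := abs_sub_round (b / (2 * π))
    have e : b - round (b / (2 * π)) * (2 * π) = (b / (2 * π) - round (b / (2 * π))) * (2 * π) := by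
      field_simp
    rw [e, abs_mul, abs_of_pos (by positivity : 0 < 2 * π)]
    nlinarith
  have hexp : Complex.exp ((n * x - b : ℝ) * I) = 1 := by
    rw [Complex.exp_eq_one_iff]
    exact ⟨-round (b / (2 * π)), by rw [hxn]; push_cast; ring⟩
  have hmod : ∀ g : ℝ → ℂ, modulate n b g x = (g x).re := fun g => by
    rw [modulate, hexp, one_mul]
  have hlow := half_difference_le_fourierDeviation_one (β := β) hα hn hν1 x (π / n)
  obtain ⟨D, hD, hDL, hDU⟩ := exists_coe_eq_of_le_of_le hlow hup
  refine ⟨D, hD, ?_⟩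
  rw [tailKernel_eq_modulate, tailKernel_eq_modulate, modulate_add_div hn, modulate_sub_pi,
    ← hb, hmod, hmod] at hDL
  have hpin : 0 < π / n := by positivity
  have h2pin : 2 * π / n = π / n + π / n := by ring
  have h1 := hre x (by linarith)
  have h2 := hre (x + π / n) (by
    have := abs_add_le x (π / n)
    rw [abs_of_pos hpin] at this
    linarith)
  have hbd : |D - E * (1 / π * (1 / δ))| ≤ 1 / π * E * (60 * (X + 1)) := by
    have hinv0 : 0 < 1 / π := by positivity
    have hL : 1 / π * (E * (1 / δ - 1 - 28 * X)) ≤ D := by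
      refine le_trans ?_ hDL
      have e : ∀ u v : ℝ, 1 / 2 * (E * u - E * -v) = E * ((u + v) / 2) := fun u v => by ring
      rw [e]
      gcongr
      linarith
    have e1 : E * (1 / π * (1 / δ)) = 1 / π * E * (1 / δ) := by ring
    have hpos : 0 < 1 / π * E := by positivity
    rw [← mul_assoc] at hL hDU
    rw [e1, abs_le]
    constructor <;> nlinarith
  refine hbd.trans ?_
  rw [mul_assoc]
  exact mul_le_of_le_one_left (by positivity) (by rw [div_le_one] <;> linarith)

end integrable

/-! ### Normalization of the remainder and the final form -/

section remainder

/-- From an absolute error bound to a normalized remainder. -/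
lemma exists_remainder {D m a T C : ℝ} (ha : 0 < a) (hT : 0 < T)
    (h : |D - a * m| ≤ a * (60 * T)) (hC : 60 ≤ C) :
    ∃ γ : ℝ, |γ| ≤ C ∧ D = a * (m + γ * T) := by
  refine ⟨(D - a * m) / (a * T), ?_, by field_simp; ring⟩
  rw [abs_div, abs_of_pos (by positivity : 0 < a * T), div_le_iff₀ (by positivity)]
  have : 0 < a * T := by positivity
  nlinarith

/-- Both deviation estimates come with the constant `60`, well inside the admissible range. -/
lemma sixty_le : (60 : ℝ) ≤ (14 * π) ^ 2 := by nlinarith [Real.pi_gt_three]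

end remainder

end PoissonFourier

end
open PoissonFourier in
theorem theorem2 (α r β : ℝ) (hα : 0 < α) (hr0 : 0 < r) (hr1 : r < 1) :
    (∀ p p' : ℝ, 1 < p → 1 / p + 1 / p' = 1 → ∀ n : ℕ, threshold α r p ≤ n →
      ∃ γ : ℝ, |γ| ≤ (14 * Real.pi) ^ 2 ∧
        fourierDeviation α r β (ENNReal.ofReal p) n =
          ((Real.exp (-α * (n : ℝ) ^ r) * (n : ℝ) ^ ((1 - r) / p) *
            ((periodNorm (ENNReal.ofReal p') Real.cos).toReal /
                  (Real.pi ^ (1 + 1 / p') * (α * r) ^ (1 / p)) *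
                (∫ t in Set.Ioi (0 : ℝ), 1 / (t ^ 2 + 1) ^ (p' / 2)) ^ (1 / p') +
              γ * (1 / (p' - 1) * ((α * r) ^ ((p' - 1) / p) / (n : ℝ) ^ ((1 - r) * (p' - 1))) +
                p ^ (1 / p') / (α * r) ^ (1 + 1 / p) * (1 / (n : ℝ) ^ r) +
                1 / (n : ℝ) ^ ((1 - r) / p))) : ℝ) : EReal)) ∧
    (∀ n : ℕ, threshold α r 1 ≤ n →
      ∃ γ : ℝ, |γ| ≤ (14 * Real.pi) ^ 2 ∧
        fourierDeviation α r β 1 n =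
          ((Real.exp (-α * (n : ℝ) ^ r) * (n : ℝ) ^ (1 - r) *
            (1 / (Real.pi * α * r) +
              γ * (1 / (α * r) ^ 2 * (1 / (n : ℝ) ^ r) + 1 / (n : ℝ) ^ (1 - r))) : ℝ) :
                EReal)) := by
  have hαr : 0 < α * r := mul_pos hα hr0
  have hpi := Real.pi_pos
  refine ⟨fun p q hp hpq' n hn => ?_, fun n hn => ?_⟩
  · have hpq : p.HolderConjugate q := by
      rw [Real.holderConjugate_iff]
      exact ⟨hp, by simpa only [one_div] using hpq'⟩
    obtain ⟨hn1, h14⟩ := le_of_threshold_le hα hr0 hr1 hp.le hn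
    have hnpos : (0 : ℝ) < n := by exact_mod_cast hn1
    obtain ⟨D, hD, hbd⟩ := exists_fourierDeviation_eq (β := β) hα hr0 hr1 hn1 hpq h14
    have hq1 : 0 < q - 1 := by linarith [hpq.symm.lt]
    have hp0 : 0 < p := by linarith
    have hq0 : 0 < q := hpq.symm.pos
    have hI : 0 < bracketIntegral q := bracketIntegral_pos hpq.symm.lt
    have hnorm : (periodNorm (ENNReal.ofReal q) Real.cos).toReal = circleNorm q Real.cos := by
      rw [periodNorm_eq hq0 Real.continuous_cos Real.cos_periodic,
        ENNReal.toReal_ofReal (circleNorm_nonneg _ _)]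
    have hδ1 : ∀ s : ℝ, decayRate α r n ^ s = (α * r) ^ s * (n : ℝ) ^ ((r - 1) * s) := fun s => by
      rw [decayRate, Real.mul_rpow hαr.le (by positivity), ← Real.rpow_mul hnpos.le]
    -- The averaging factor `(2 π) ^ (-1 / q)` meets the `2 ^ (1 / q)` coming from the two
    -- half-lines, and only `π ^ (-1 / q)` survives.
    have e0 : 1 / (π ^ (1 + 1 / q) * (α * r) ^ (1 / p)) * (n : ℝ) ^ ((1 - r) / p) *
        bracketIntegral q ^ (1 / q) = 1 / π * (1 / (2 * π) ^ (1 / q) * lineNorm p q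
          (decayRate α r n)) := by
      rw [lineNorm, hδ1, Real.mul_rpow two_pos.le hI.le, Real.mul_rpow two_pos.le hpi.le,
        Real.rpow_add hpi, Real.rpow_one, Real.rpow_neg hαr.le]
      have : (r - 1) * -(1 / p) = (1 - r) / p := by ring
      rw [this]
      field_simp
    have e1 : (n : ℝ) ^ ((1 - r) / p) *
        (1 / (q - 1) * ((α * r) ^ ((q - 1) / p) / (n : ℝ) ^ ((1 - r) * (q - 1)))) =
        decayRate α r n ^ ((q - 1) / p) / (q - 1) := by
      -- The exponents agree because `(q - 1) (1 - 1 / p) = 1 / p`.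
      have h1 : (n : ℝ) ^ ((r - 1) * ((q - 1) / p)) * (n : ℝ) ^ ((1 - r) * (q - 1)) =
          (n : ℝ) ^ ((1 - r) / p) := by
        rw [← Real.rpow_add hnpos]
        congr 1
        have := hpq.mul_eq_add
        field_simp
        linear_combination (1 - r) * this
      rw [hδ1, ← h1]
      field_simp
    have e2 : (n : ℝ) ^ ((1 - r) / p) *
        (p ^ (1 / q) / (α * r) ^ (1 + 1 / p) * (1 / (n : ℝ) ^ r)) =
        p ^ (1 / q) * decayRate α r n ^ (-(1 / p)) / (n * decayRate α r n) := by
      rw [nat_mul_decayRate α r hn1, hδ1, Real.rpow_add hαr, Real.rpow_one,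
        Real.rpow_neg hαr.le]
      have : (r - 1) * -(1 / p) = (1 - r) / p := by ring
      rw [this]
      field_simp
    have e3 : (n : ℝ) ^ ((1 - r) / p) * (1 / (n : ℝ) ^ ((1 - r) / p)) = 1 := by
      have : 0 < (n : ℝ) ^ ((1 - r) / p) := by positivity
      field_simp
    have h := exists_remainder (D := D)
      (m := circleNorm q Real.cos / (π ^ (1 + 1 / q) * (α * r) ^ (1 / p)) *
        bracketIntegral q ^ (1 / q))
      (a := Real.exp (-α * (n : ℝ) ^ r) * (n : ℝ) ^ ((1 - r) / p))
      (T := 1 / (q - 1) * ((α * r) ^ ((q - 1) / p) / (n : ℝ) ^ ((1 - r) * (q - 1))) +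
                p ^ (1 / q) / (α * r) ^ (1 + 1 / p) * (1 / (n : ℝ) ^ r) +
                1 / (n : ℝ) ^ ((1 - r) / p)) (by positivity) (by positivity) ?_ sixty_le
    · obtain ⟨γ, hγ, hγD⟩ := h
      refine ⟨γ, hγ, ?_⟩
      rw [hD, hγD, hnorm]
      rfl
    · refine le_of_eq_of_le ?_ (hbd.trans_eq ?_)
      · congr 2
        rw [div_eq_mul_one_div (circleNorm q Real.cos) ((2 * π) ^ (1 / q)),
          mul_assoc (circleNorm q Real.cos), mul_left_comm (1 / π), ← e0]
        ring
      · rw [mul_assoc (Real.exp _), mul_left_comm ((n : ℝ) ^ ((1 - r) / p)) 60,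
          mul_add ((n : ℝ) ^ ((1 - r) / p)), mul_add ((n : ℝ) ^ ((1 - r) / p)), e1, e2, e3]
  · obtain ⟨hn1, h14⟩ := le_of_threshold_le hα hr0 hr1 le_rfl hn
    have hnpos : (0 : ℝ) < n := by exact_mod_cast hn1
    obtain ⟨D, hD, hbd⟩ := exists_fourierDeviation_one_eq (β := β) hα hr0 hr1 hn1 h14
    have hδ : decayRate α r n = α * r / (n : ℝ) ^ (1 - r) := by
      rw [decayRate, ← neg_sub 1 r, Real.rpow_neg hnpos.le]; rfl
    have hN : 0 < (n : ℝ) ^ (1 - r) := by positivity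
    have h := exists_remainder (D := D) (m := 1 / (π * α * r))
      (a := Real.exp (-α * (n : ℝ) ^ r) * (n : ℝ) ^ (1 - r))
      (T := 1 / (α * r) ^ 2 * (1 / (n : ℝ) ^ r) + 1 / (n : ℝ) ^ (1 - r))
      (by positivity) (by positivity) ?_ sixty_le
    · obtain ⟨γ, hγ, hγD⟩ := h
      exact ⟨γ, hγ, by rw [hD, hγD]⟩
    · refine le_of_eq_of_le ?_ (hbd.trans_eq ?_)
      · congr 2
        rw [hδ]
        field_simp
      · rw [nat_mul_decayRate α r hn1, hδ]
        field_simp
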